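/- Consider rotationally symmetric metrics $g=E(r)^2dr^2+G(r)^2d\theta^2$ on the annulus $[r_1,r_2]\times S^1$ (with $S^1=\mathbb{R}/2\pi\mathbb{Z}$), where $r_1<r_2$ and $E,G>0$ are smooth up to the boundary. Such a metric is isometric to $f(t)^2(dt^2+d\theta^2)$ on $[0,T]\times S^1$, where $T=\int_{r_1}^{r_2}E/G\,dr$ is its (conformal) modulus. Let $L=2\pi(G(r_1)+G(r_2))$ be its boundary length, $\alpha=G(r_1)/G(r_2)$ the ratio of the lengths of its boundary circles, and $\sigma_1$ the smallest positive eigenvalue of its Dirichlet-to-Neumann map (which exists). With $f_0=G(r_1)$ and $f_T=G(r_2)$ put $$\lambda_0^{(2)}=\frac{f_0+f_T}{f_0f_TT},\qquad \lambda_1^{(1)}=\tfrac12\Big((f_0^{-1}+f_T^{-1})\coth T-\sqrt{(f_0^{-1}+f_T^{-1})^2\coth^2T-4f_0^{-1}f_T^{-1}}\Big).$$ For $\alpha>0$ let $T(\alpha)>0$ denote the number such that, among metrics with boundary length ratio $\alpha$, $\sigma_1=\lambda_1^{(1)}$ if the modulus is at most $T(\alpha)$ and $\sigma_1=\lambda_0^{(2)}$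 if it is at least $T(\alpha)$. **Theorem 3.1.** For every $a\in\mathbb{R}$ the equations $t_1=\coth(t_1+a)$ and $t_2=\coth(t_2-a)$ have unique positive solutions $t_1=t_1(a)$, $t_2=t_2(a)$. The function $\alpha(a)=t_1(a)/t_2(a)$ is strictly decreasing in $a$ with range $(0,\infty)$. For every $a$, with $\alpha=\alpha(a)$, the number $T(\alpha)$ exists, is unique and equals $t_1+t_2$; the maximum of $\sigma_1L$ over all rotationally symmetric metrics with boundary length ratio $\alpha$ exists and equals $2\pi(t_1^{-1}+t_2^{-1})$; and a metric with this ratio attains it if and only if its modulus is $T(\alpha)$. Let $\tau=t_1(0)=t_2(0)$ be the positive solution of $\tau=\coth\tau$. The maximum $2\pi(t_1^{-1}+t_2^{-1})$ equals $4\pi/\tau$ only for $a=0$, that is, $\alpha=1$; the maximum of $\sigma_1L$ over all rotationally symmetric metrics exists and equals $4\pi/\tau$; it is attained by a metric if and only if $\alpha=1$ and the modulus is $T(1)=2\tau$; and for every such metric $\sigma_1$ has multiplicity $3$. The critical catenoid, i.e. the piece $r_1\le t\le r_2$ of a catenoid $c\,(\cosh t\cos\theta,\cosh t\sin\theta,t)$,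 $c>0$, that lies in the closed unit ball, has its boundary on the unit sphere and meets the sphere orthogonally, with the induced metric, exists, attains this maximum, and its $\sigma_1$ has multiplicity $3$. Numerically $|\tau-1.2|<0.05$. -/

import Mathlib

open Real Set
open scoped ContDiff

/-- The hyperbolic cotangent. -/
noncomputable def coth (x : ℝ) : ℝ := Real.cosh x / Real.sinh x

/-- A smooth (up to the boundary) rotationally symmetric Riemannian metric
`E(r)² dr² + G(r)² dθ²` on the annulus `[r₁, r₂] × S¹`, where `θ ∈ S¹ = ℝ / 2πℤ`.
The case `E = 1` is the form `dr² + a(r)² dθ²` and the case `E = G = f` is the conformal form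
`f(t)² (dt² + dθ²)`. -/
structure RotMetric where
  r₁ : ℝ
  r₂ : ℝ
  lt : r₁ < r₂
  E : ℝ → ℝ
  G : ℝ → ℝ
  smooth_E : ContDiffOn ℝ ∞ E (Icc r₁ r₂)
  smooth_G : ContDiffOn ℝ ∞ G (Icc r₁ r₂)
  pos_E : ∀ r ∈ Icc r₁ r₂, 0 < E r
  pos_G : ∀ r ∈ Icc r₁ r₂, 0 < G r

namespace RotMetric

/-- The conformal modulus: `t = ∫ E / G dr` is the coordinate in which the metric becomes
`f(t)² (dt² + dθ²)`, and its range is the interval `[0, T]`, where `T` is this number. -/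
noncomputable def modulus (g : RotMetric) : ℝ := ∫ r in g.r₁..g.r₂, g.E r / g.G r

/-- The length of the boundary circle `r = r₁`. -/
noncomputable def innerLength (g : RotMetric) : ℝ := 2 * π * g.G g.r₁

/-- The length of the boundary circle `r = r₂`. -/
noncomputable def outerLength (g : RotMetric) : ℝ := 2 * π * g.G g.r₂

/-- The length of the whole boundary. -/
noncomputable def boundaryLength (g : RotMetric) : ℝ := g.innerLength + g.outerLength

/-- The ratio of the two boundary lengths. -/
noncomputable def ratio (g : RotMetric) : ℝ := g.innerLength / g.outerLength

/-- Functions on the closed annulus that are smooth up to the boundary, written as functions of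
`(r, θ)` that are `2π`-periodic in `θ`. Values outside `[r₁, r₂]` are irrelevant. -/
structure IsSmooth (g : RotMetric) (u : ℝ → ℝ → ℝ) : Prop where
  contDiffOn : ContDiffOn ℝ ∞ (fun p : ℝ × ℝ => u p.1 p.2) (Icc g.r₁ g.r₂ ×ˢ univ)
  periodic : ∀ r ∈ Icc g.r₁ g.r₂, Function.Periodic (u r) (2 * π)

/-- The Laplace–Beltrami operator of `E² dr² + G² dθ²`. -/
noncomputable def laplacian (g : RotMetric) (u : ℝ → ℝ → ℝ) (r θ : ℝ) : ℝ :=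
  (g.E r * g.G r)⁻¹ *
    (deriv (fun ρ => g.G ρ / g.E ρ * deriv (fun s => u s θ) ρ) r
      + g.E r / g.G r * deriv (deriv (u r)) θ)

/-- The outward unit conormal derivative on the circle `r = r₁`, where `ν = -E⁻¹ ∂_r`. -/
noncomputable def innerConormalDeriv (g : RotMetric) (u : ℝ → ℝ → ℝ) (θ : ℝ) : ℝ :=
  -((g.E g.r₁)⁻¹ * derivWithin (fun r => u r θ) (Icc g.r₁ g.r₂) g.r₁)

/-- The outward unit conormal derivative on the circle `r = r₂`, where `ν = E⁻¹ ∂_r`. -/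
noncomputable def outerConormalDeriv (g : RotMetric) (u : ℝ → ℝ → ℝ) (θ : ℝ) : ℝ :=
  (g.E g.r₂)⁻¹ * derivWithin (fun r => u r θ) (Icc g.r₁ g.r₂) g.r₂

/-- The graph of the Dirichlet-to-Neumann map. A function on the boundary is a pair of functions
of `θ`, on `r = r₁` and on `r = r₂`. The map sends `φ` to `ψ` if `φ` has a harmonic extension,
smooth up to the boundary, with outward conormal derivative `ψ`. -/
def IsDirichletToNeumann (g : RotMetric) (φ ψ : (ℝ → ℝ) × (ℝ → ℝ)) : Prop :=
  ∃ u : ℝ → ℝ → ℝ, g.IsSmooth u ∧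
    (∀ r ∈ Ioo g.r₁ g.r₂, ∀ θ, g.laplacian u r θ = 0) ∧
    (∀ θ, u g.r₁ θ = φ.1 θ) ∧ (∀ θ, u g.r₂ θ = φ.2 θ) ∧
    (∀ θ, g.innerConormalDeriv u θ = ψ.1 θ) ∧ (∀ θ, g.outerConormalDeriv u θ = ψ.2 θ)

theorem IsSmooth.radial {g : RotMetric} {u : ℝ → ℝ → ℝ} (hu : g.IsSmooth u) (θ : ℝ) :
    ContDiffOn ℝ ∞ (fun r => u r θ) (Icc g.r₁ g.r₂) :=
  hu.contDiffOn.comp (f := fun r : ℝ => (r, θ)) (by fun_prop) (fun r hr => ⟨hr, mem_univ _⟩)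

theorem IsSmooth.angular {g : RotMetric} {u : ℝ → ℝ → ℝ} (hu : g.IsSmooth u) {r : ℝ}
    (hr : r ∈ Icc g.r₁ g.r₂) : ContDiff ℝ ∞ (u r) := by
  rw [← contDiffOn_univ]
  exact hu.contDiffOn.comp (f := fun θ : ℝ => (r, θ)) (by fun_prop)
    (fun θ _ => ⟨hr, mem_univ _⟩)

theorem differentiableAt_flux (g : RotMetric) {u : ℝ → ℝ → ℝ} (hu : g.IsSmooth u) {r : ℝ}
    (hr : r ∈ Ioo g.r₁ g.r₂) (θ : ℝ) :
    DifferentiableAt ℝ (fun ρ => g.G ρ / g.E ρ * deriv (fun s => u s θ) ρ) r := by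
  have hn : Icc g.r₁ g.r₂ ∈ nhds r := Icc_mem_nhds hr.1 hr.2
  have hE : DifferentiableAt ℝ g.E r := (g.smooth_E.contDiffAt hn).differentiableAt (by simp)
  have hG : DifferentiableAt ℝ g.G r := (g.smooth_G.contDiffAt hn).differentiableAt (by simp)
  have h2 : DifferentiableAt ℝ (deriv (fun s => u s θ)) r := by
    have h := ((hu.radial θ).mono Ioo_subset_Icc_self).deriv_of_isOpen (m := ∞) isOpen_Ioo
      (by simp)
    exact (h.contDiffAt (Ioo_mem_nhds hr.1 hr.2)).differentiableAt (by simp)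
  exact (hG.div hE (g.pos_E r (Ioo_subset_Icc_self hr)).ne').mul h2

theorem laplacian_add (g : RotMetric) {u v : ℝ → ℝ → ℝ} (hu : g.IsSmooth u) (hv : g.IsSmooth v)
    {r : ℝ} (hr : r ∈ Ioo g.r₁ g.r₂) (θ : ℝ) :
    g.laplacian (fun r θ => u r θ + v r θ) r θ = g.laplacian u r θ + g.laplacian v r θ := by
  have hn : Ioo g.r₁ g.r₂ ∈ nhds r := Ioo_mem_nhds hr.1 hr.2
  have key : (fun ρ => g.G ρ / g.E ρ * deriv (fun s => u s θ + v s θ) ρ) =ᶠ[nhds r]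
      (fun ρ => g.G ρ / g.E ρ * deriv (fun s => u s θ) ρ) +
        (fun ρ => g.G ρ / g.E ρ * deriv (fun s => v s θ) ρ) := by
    filter_upwards [hn] with ρ hρ
    have hm : Icc g.r₁ g.r₂ ∈ nhds ρ := Icc_mem_nhds hρ.1 hρ.2
    have h1 := ((hu.radial θ).contDiffAt hm).differentiableAt (by simp)
    have h2 := ((hv.radial θ).contDiffAt hm).differentiableAt (by simp)
    simp only [Pi.add_apply]
    rw [deriv_fun_add h1 h2]
    ring
  have hI := Ioo_subset_Icc_self hr
  have ha : deriv (fun θ => u r θ + v r θ) = deriv (u r) + deriv (v r) := by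
    funext x
    exact deriv_fun_add ((hu.angular hI).differentiable (by simp) x)
      ((hv.angular hI).differentiable (by simp) x)
  have hd : ∀ {w : ℝ → ℝ → ℝ}, g.IsSmooth w → DifferentiableAt ℝ (deriv (w r)) θ := fun hw =>
    (contDiff_infty.1 (hw.angular hI) 2).differentiable_deriv_two.differentiableAt
  unfold laplacian
  rw [key.deriv_eq, deriv_add (g.differentiableAt_flux hu hr θ) (g.differentiableAt_flux hv hr θ),
    ha, deriv_add (hd hu) (hd hv)]
  ring

theorem laplacian_smul (g : RotMetric) (c : ℝ) (u : ℝ → ℝ → ℝ) (r θ : ℝ) :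
    g.laplacian (fun r θ => c * u r θ) r θ = c * g.laplacian u r θ := by
  have h1 : (fun ρ => g.G ρ / g.E ρ * deriv (fun s => c * u s θ) ρ) =
      fun ρ => c * (g.G ρ / g.E ρ * deriv (fun s => u s θ) ρ) := by
    funext ρ
    rw [deriv_const_mul_field]
    ring
  have h2 : deriv (fun θ => c * u r θ) = fun θ => c * deriv (u r) θ := by
    funext x
    rw [deriv_const_mul_field]
  unfold laplacian
  rw [h1, h2, deriv_const_mul_field, deriv_const_mul_field]
  ring

/-- The eigenspace of the Dirichlet-to-Neumann map for the number `lam`, in the smooth functions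
on the boundary. -/
def eigenspace (g : RotMetric) (lam : ℝ) : Submodule ℝ ((ℝ → ℝ) × (ℝ → ℝ)) where
  carrier := {φ | g.IsDirichletToNeumann φ (lam • φ)}
  zero_mem' := by
    refine ⟨fun _ _ => 0, ⟨contDiffOn_const, fun r _ θ => rfl⟩, ?_, ?_, ?_, ?_, ?_⟩ <;>
      simp [laplacian, innerConormalDeriv, outerConormalDeriv]
  add_mem' := by
    rintro φ ψ ⟨u, hu, hu0, hu1, hu2, hu3, hu4⟩ ⟨v, hv, hv0, hv1, hv2, hv3, hv4⟩
    have hd : ∀ {w : ℝ → ℝ → ℝ}, g.IsSmooth w → ∀ r ∈ Icc g.r₁ g.r₂, ∀ θ,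
        DifferentiableWithinAt ℝ (fun r => w r θ) (Icc g.r₁ g.r₂) r := fun hw r hr θ =>
      (hw.radial θ).differentiableOn (by simp) r hr
    have hl := left_mem_Icc.2 g.lt.le
    have hr := right_mem_Icc.2 g.lt.le
    refine ⟨fun r θ => u r θ + v r θ, ⟨hu.contDiffOn.add hv.contDiffOn, fun r hr =>
      (hu.periodic r hr).add (hv.periodic r hr)⟩, ?_, ?_, ?_, ?_, ?_⟩
    · intro r hr θ
      rw [g.laplacian_add hu hv hr, hu0 r hr, hv0 r hr, add_zero]
    · intro θ
      simp [hu1, hv1]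
    · intro θ
      simp [hu2, hv2]
    · intro θ
      have h1 := hu3 θ
      have h2 := hv3 θ
      simp only [innerConormalDeriv, Prod.smul_fst, Pi.smul_apply, smul_eq_mul, Prod.fst_add,
        Pi.add_apply] at h1 h2 ⊢
      rw [derivWithin_fun_add (hd hu _ hl θ) (hd hv _ hl θ)]
      linarith
    · intro θ
      have h1 := hu4 θ
      have h2 := hv4 θ
      simp only [outerConormalDeriv, Prod.smul_snd, Pi.smul_apply, smul_eq_mul, Prod.snd_add,
        Pi.add_apply] at h1 h2 ⊢
      rw [derivWithin_fun_add (hd hu _ hr θ) (hd hv _ hr θ)]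
      linarith
  smul_mem' := by
    rintro c φ ⟨u, hu, hu0, hu1, hu2, hu3, hu4⟩
    refine ⟨fun r θ => c * u r θ, ⟨contDiffOn_const.mul hu.contDiffOn, fun r hr θ => by
      simp only [hu.periodic r hr θ]⟩, ?_, ?_, ?_, ?_, ?_⟩
    · intro r hr θ
      rw [laplacian_smul, hu0 r hr, mul_zero]
    · intro θ
      simp [hu1]
    · intro θ
      simp [hu2]
    · intro θ
      have h1 := hu3 θ
      simp only [innerConormalDeriv, Prod.smul_fst, Pi.smul_apply, smul_eq_mul] at h1 ⊢
      rw [derivWithin_const_mul_field]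
      linear_combination c * h1
    · intro θ
      have h1 := hu4 θ
      simp only [outerConormalDeriv, Prod.smul_snd, Pi.smul_apply, smul_eq_mul] at h1 ⊢
      rw [derivWithin_const_mul_field]
      linear_combination c * h1

/-- The positive eigenvalues of the Dirichlet-to-Neumann map. -/
def positiveEigenvalues (g : RotMetric) : Set ℝ := {lam | 0 < lam ∧ g.eigenspace lam ≠ ⊥}

/-- The first nonzero Steklov eigenvalue. -/
noncomputable def sigma1 (g : RotMetric) : ℝ := sInf g.positiveEigenvalues

/-- The multiplicity of the first nonzero Steklov eigenvalue. -/
noncomputable def sigma1Multiplicity (g : RotMetric) : ℕ :=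
  Module.finrank ℝ (g.eigenspace g.sigma1)

/-- The scale-invariant quantity `σ₁ L`. -/
noncomputable def sigma1L (g : RotMetric) : ℝ := g.sigma1 * g.boundaryLength

/-- The nonzero Steklov eigenvalue with rotationally invariant eigenfunctions. -/
noncomputable def lambda02 (g : RotMetric) : ℝ :=
  (g.G g.r₁ + g.G g.r₂) / (g.G g.r₁ * g.G g.r₂ * g.modulus)

/-- The smaller Steklov eigenvalue with eigenfunctions of the form `h(r) cos θ`, `h(r) sin θ`. -/
noncomputable def lambda11 (g : RotMetric) : ℝ :=
  (((g.G g.r₁)⁻¹ + (g.G g.r₂)⁻¹) * coth g.modulus -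
    √(((g.G g.r₁)⁻¹ + (g.G g.r₂)⁻¹) ^ 2 * coth g.modulus ^ 2
      - 4 * (g.G g.r₁)⁻¹ * (g.G g.r₂)⁻¹)) / 2

end RotMetric

/-- `T` is the transition modulus `T(α)`: among metrics with boundary ratio `α`, the first
eigenvalue is `lambda11` if the modulus is at most `T`, and `lambda02` if it is at least `T`. -/
def IsTransitionModulus (α T : ℝ) : Prop :=
  0 < T ∧ ∀ g : RotMetric, g.ratio = α →
    (g.modulus ≤ T → g.sigma1 = g.lambda11) ∧ (T ≤ g.modulus → g.sigma1 = g.lambda02)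

/-- The standard parametrization of the catenoid. -/
noncomputable def catenoid (t θ : ℝ) : EuclideanSpace ℝ (Fin 3) :=
  !₂[Real.cosh t * Real.cos θ, Real.cosh t * Real.sin θ, t]

/-- `g` is the induced metric of the critical catenoid: for some scale `c > 0`, the part
`r₁ ≤ t ≤ r₂` of the catenoid scaled by `c` lies in the closed unit ball, has its boundary on the
unit sphere, and meets the sphere orthogonally (the outward unit conormal is the position
vector), and `g` is the metric induced from `ℝ³`. -/
def IsCriticalCatenoid (g : RotMetric) : Prop :=
  ∃ c : ℝ, 0 < c ∧
    (∀ t ∈ Icc g.r₁ g.r₂, ∀ θ,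
      inner ℝ (deriv (fun s => c • catenoid s θ) t) (deriv (fun s => c • catenoid s θ) t)
        = g.E t ^ 2 ∧
      inner ℝ (deriv (fun s => c • catenoid s θ) t) (deriv (fun η => c • catenoid t η) θ) = 0 ∧
      inner ℝ (deriv (fun η => c • catenoid t η) θ) (deriv (fun η => c • catenoid t η) θ)
        = g.G t ^ 2) ∧
    (∀ t ∈ Icc g.r₁ g.r₂, ∀ θ, ‖c • catenoid t θ‖ ≤ 1) ∧
    (∀ θ, ‖c • catenoid g.r₁ θ‖ = 1 ∧ ‖c • catenoid g.r₂ θ‖ = 1) ∧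
    (∀ θ, -((g.E g.r₁)⁻¹ • deriv (fun s => c • catenoid s θ) g.r₁) = c • catenoid g.r₁ θ ∧
      (g.E g.r₂)⁻¹ • deriv (fun s => c • catenoid s θ) g.r₂ = c • catenoid g.r₂ θ)

/-! In the conformal coordinate `t = ∫ E / G dr` on `[0, T]` a function on the annulus is harmonic
iff it is harmonic for the flat metric `dt² + dθ²`, so its Fourier coefficients of order `n`
satisfy `c'' = n² c`. The first integrals `exp (± n t) (c' ∓ n c)` turn the two Steklov conditions
into a linear system for `(c(0), c(T))` (`RotMetric.mode_relation`). For `n = 0` it forces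
`λ = λ₀⁽²⁾`. For `n ≥ 1` its determinant says that `μ = λ / n` solves
`μ² - (f₀⁻¹ + f_T⁻¹) coth (n T) μ + f₀⁻¹ f_T⁻¹ = 0`, whose smaller root increases with the modulus
`n T`, so that `λ ≥ n λ₁⁽¹⁾` (`RotMetric.lambda11_le_of_mode`). As a continuous function with
vanishing Fourier coefficients is zero, `σ₁ = min λ₁⁽¹⁾ λ₀⁽²⁾`
(`RotMetric.isLeast_positiveEigenvalues`), and if the two numbers agree, the modes of order `0` and
`1` make up the whole eigenspace, of dimension `3`.

For a fixed ratio of the boundary lengths `λ₀⁽²⁾` decreases and `λ₁⁽¹⁾` increases with `T`, so `σ₁ L`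
is largest where they meet. With the boundary values `k t₁`, `k t₂`, the addition theorem for `coth`
shows that this happens for `T = t₁ + t₂`, with common value `(k t₁ t₂)⁻¹`
(`smallRoot_transition`, `RotMetric.eigenvalue_crossing`).

To compare different ratios put `x = t₁ + a`, `y = t₂ - a`, `S = x + y = coth x + coth y`. Then
`sinh x sinh y = sinh S / S`, whence `t₁⁻¹ + t₂⁻¹ = tanh x + tanh y = (coth S - S⁻¹)⁻¹`, the reciprocal
of the increasing Langevin function. The inequality `1 ≤ cosh (x - y) = cosh S - 2 sinh S / S` says
`coth (S / 2) ≤ S / 2`, that is, `S ≥ 2 τ`, with equality only for `x = y`, that is, for `a = 0`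
(`inv_add_inv_lt`). -/

/-! ### The hyperbolic cotangent and its fixed points -/

theorem one_lt_coth {x : ℝ} (hx : 0 < x) : 1 < coth x :=
  (one_lt_div (sinh_pos_iff.2 hx)).2 (sinh_lt_cosh x)

theorem coth_pos_iff {x : ℝ} : 0 < coth x ↔ 0 < x := by
  refine ⟨fun h => ?_, fun h => one_pos.trans (one_lt_coth h)⟩
  by_contra hx
  exact h.not_ge (div_nonpos_of_nonneg_of_nonpos (cosh_pos x).le (sinh_nonpos_iff.2 (not_lt.1 hx)))

theorem coth_neg (x : ℝ) : coth (-x) = -coth x := by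
  simp [coth, div_neg]

theorem coth_mul_sinh {x : ℝ} (hx : 0 < x) : coth x * sinh x = cosh x :=
  div_mul_cancel₀ _ (sinh_pos_iff.2 hx).ne'

theorem coth_mul_exp_sub_one {x : ℝ} (hx : 0 < x) :
    coth x * (exp (2 * x) - 1) = exp (2 * x) + 1 := by
  have e1 : exp (2 * x) = exp x * exp x := by rw [← exp_add]; ring_nf
  have e2 : exp x * exp (-x) = 1 := by rw [← exp_add]; simp
  have e3 := coth_mul_sinh hx
  rw [sinh_eq, cosh_eq] at e3
  rw [e1]
  linear_combination 2 * exp x * e3 + (1 + coth x) * e2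

theorem coth_lt_coth {x y : ℝ} (hx : 0 < x) (hxy : x < y) : coth y < coth x := by
  have h1 := sinh_pos_iff.2 hx
  have h2 := sinh_pos_iff.2 (hx.trans hxy)
  have h3 := sinh_pos_iff.2 (sub_pos.2 hxy)
  rw [sinh_sub] at h3
  unfold coth
  rw [div_lt_div_iff₀ h2 h1]
  linarith

theorem coth_le_coth {x y : ℝ} (hx : 0 < x) (hxy : x ≤ y) : coth y ≤ coth x := by
  rcases hxy.eq_or_lt with rfl | h
  · exact le_rfl
  · exact (coth_lt_coth hx h).le

theorem hasDerivAt_coth {x : ℝ} (hx : 0 < x) : HasDerivAt coth (-(sinh x ^ 2)⁻¹) x := by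
  have hs := sinh_pos_iff.2 hx
  refine ((hasDerivAt_cosh x).div (hasDerivAt_sinh x) hs.ne').congr_deriv ?_
  have := cosh_sq x
  field_simp
  linarith

/-- If `a < b`, then the fixed point `t = coth (t + b)` lies below the fixed point
`s = coth (s + a)`, but by less than `b - a`. -/
theorem fixedPoint_lt {s t a b : ℝ} (hs : 0 < s) (hsa : s = coth (s + a)) (ht : 0 < t)
    (htb : t = coth (t + b)) (hab : a < b) : t < s ∧ s + a < t + b := by
  have h1 : 0 < s + a := coth_pos_iff.1 (hsa ▸ hs)
  have h2 : 0 < t + b := coth_pos_iff.1 (htb ▸ ht)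
  have h3 : s + a < t + b := by
    by_contra h
    have := coth_le_coth h2 (not_lt.1 h)
    linarith
  exact ⟨by rw [hsa, htb]; exact coth_lt_coth h1 h3, h3⟩

theorem existsUnique_eq_coth_add (a : ℝ) : ∃! t : ℝ, 0 < t ∧ t = coth (t + a) := by
  -- `x = t + a` solves `x - coth x = a`; the left side runs from `-|a|` or less at
  -- `arsinh (1 / (|a| + 1))` to `|a|` or more at `|a| + 2`
  obtain ⟨l, hl⟩ := sinh_surjective (|a| + 1)⁻¹
  have hlow : 0 < l := sinh_pos_iff.1 (hl ▸ by positivity)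
  have hl1 : l ≤ 1 :=
    (self_le_sinh_iff.2 hlow.le).trans (hl ▸ inv_le_one_of_one_le₀ (by linarith [abs_nonneg a]))
  have hle : l ≤ |a| + 2 := by linarith [abs_nonneg a]
  have hc : ContinuousOn (fun x => x - coth x) (Icc l (|a| + 2)) := fun x hx =>
    (continuousAt_id.sub (hasDerivAt_coth (hlow.trans_le hx.1)).continuousAt).continuousWithinAt
  have h1 : l - coth l ≤ a := by
    have : |a| + 1 ≤ coth l := by
      rw [coth, hl, div_inv_eq_mul]
      exact le_mul_of_one_le_left (by positivity) (one_le_cosh l)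
    linarith [neg_abs_le a]
  have h2 : a ≤ |a| + 2 - coth (|a| + 2) := by
    have hx : coth (|a| + 2) ≤ coth 2 := coth_le_coth two_pos (by linarith [abs_nonneg a])
    have : coth 2 ≤ 2 := by
      have he := self_lt_sinh_iff.2 (one_pos (α := ℝ))
      rw [coth, div_le_iff₀ (sinh_pos_iff.2 two_pos), show (2 : ℝ) = 2 * 1 by norm_num,
        cosh_two_mul, sinh_two_mul, cosh_sq]
      nlinarith [sinh_lt_cosh 1, cosh_sq 1]
    linarith [le_abs_self a]
  obtain ⟨x, hx, hxa⟩ := intermediate_value_Icc hle hc ⟨h1, h2⟩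
  have hx0 : 0 < x := hlow.trans_le hx.1
  have hxa' : coth x + a = x := by simp only at hxa; linarith
  refine ⟨coth x, ⟨coth_pos_iff.2 hx0, by rw [hxa']⟩, ?_⟩
  rintro t ⟨ht, hta⟩
  rw [← hxa'] at hx0
  have h0 : 0 < t + a := coth_pos_iff.1 (hta ▸ ht)
  rcases lt_trichotomy (t + a) (coth x + a) with h | h | h
  · have := coth_lt_coth h0 h
    rw [← hta, hxa'] at this
    linarith
  · linarith
  · have := coth_lt_coth hx0 h
    rw [← hta, hxa'] at this
    linarith

/-- The Langevin function `coth x - x⁻¹` is strictly increasing on the positive axis. -/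
theorem strictMonoOn_langevin : StrictMonoOn (fun x => coth x - x⁻¹) (Ioi 0) := by
  have hd : ∀ x ∈ Ioi (0 : ℝ), HasDerivAt (fun x => coth x - x⁻¹)
      (-(sinh x ^ 2)⁻¹ - -(x ^ 2)⁻¹) x := fun x hx =>
    (hasDerivAt_coth hx).sub (hasDerivAt_inv (ne_of_gt hx))
  refine strictMonoOn_of_deriv_pos (convex_Ioi 0)
    (fun x hx => (hd x hx).continuousAt.continuousWithinAt) fun x hx => ?_
  rw [interior_Ioi] at hx
  rw [(hd x hx).deriv]
  have h := self_lt_sinh_iff.2 hx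
  have hx' : 0 < x := hx
  have : (sinh x ^ 2)⁻¹ < (x ^ 2)⁻¹ := by gcongr
  linarith

/-- On the curve `x + y = coth x + coth y` the sum `tanh x + tanh y` depends on `x + y` only. -/
theorem inv_coth_add_inv_coth {x y : ℝ} (hx : 0 < x) (hy : 0 < y)
    (h : x + y = coth x + coth y) :
    (coth x)⁻¹ + (coth y)⁻¹ = (coth (x + y) - (x + y)⁻¹)⁻¹ := by
  have h1 := sinh_pos_iff.2 hx
  have h2 := sinh_pos_iff.2 hy
  have h3 := sinh_pos_iff.2 (add_pos hx hy)
  have hS := add_pos hx hy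
  have c1 := cosh_pos x
  have c2 := cosh_pos y
  have key : (x + y)⁻¹ = sinh x * sinh y / sinh (x + y) := by
    rw [inv_eq_one_div, div_eq_div_iff hS.ne' h3.ne', sinh_add, h]
    unfold coth
    field_simp
    ring
  rw [key]
  unfold coth
  rw [← sub_div, cosh_add, inv_div, inv_div, inv_div, sinh_add]
  have : cosh x * cosh y + sinh x * sinh y - sinh x * sinh y = cosh x * cosh y := by ring
  rw [this]
  field_simp

/-- On the curve `x + y = coth x + coth y` the half-sum `m` satisfies `coth m ≤ m`. Indeed
`2 sinh x sinh y = cosh (x + y) - cosh (x - y)` is largest at `x = y` for a given sum. -/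
theorem coth_half_lt {x y : ℝ} (hx : 0 < x) (hy : 0 < y) (hxy : x ≠ y)
    (h : x + y = coth x + coth y) : coth ((x + y) / 2) < (x + y) / 2 := by
  have h1 := sinh_pos_iff.2 hx
  have h2 := sinh_pos_iff.2 hy
  have hm : 0 < (x + y) / 2 := by positivity
  set m := (x + y) / 2 with hm'
  have h3 := sinh_pos_iff.2 hm
  have hprod : 2 * m * (sinh x * sinh y) = sinh (2 * m) := by
    rw [show 2 * m = x + y by rw [hm']; ring, sinh_add, h]
    unfold coth
    field_simp
    ring
  have hlt : sinh x * sinh y < sinh m ^ 2 := by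
    have e1 : sinh x * sinh y * 2 = cosh (2 * m) - cosh (x - y) := by
      rw [show 2 * m = x + y by rw [hm']; ring, cosh_add, cosh_sub]
      ring
    have e2 : 1 < cosh (x - y) := one_lt_cosh.2 (sub_ne_zero.2 hxy)
    have e3 := cosh_two_mul m
    have e4 := cosh_sq m
    linarith
  rw [sinh_two_mul] at hprod
  rw [coth, div_lt_iff₀ h3]
  have : sinh m * cosh m < sinh m * (m * sinh m) := by nlinarith
  exact lt_of_mul_lt_mul_left this h3.le

theorem lt_of_coth_lt_self {τ m : ℝ} (h : τ = coth τ) (hm : coth m < m) (hm0 : 0 < m) :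
    τ < m := by
  by_contra hc
  have := coth_le_coth hm0 (not_lt.1 hc)
  linarith

theorem abs_sub_lt_of_eq_coth {τ : ℝ} (hτ : 0 < τ) (h : τ = coth τ) : |τ - 1.2| < 0.05 := by
  have e1 := exp_one_gt_d9
  have e2 := exp_one_lt_d9
  have e5 : exp (2 * 1.25) ^ 2 = exp 1 ^ 5 := by
    rw [← exp_nat_mul, ← exp_nat_mul]; norm_num
  have hlo : (9 : ℝ) < exp (2 * 1.25) := by
    have : (2.7 : ℝ) ^ 5 < exp 1 ^ 5 := by gcongr; linarith
    refine lt_of_pow_lt_pow_left₀ 2 (exp_pos _).le ?_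
    rw [e5]
    exact lt_trans (by norm_num) this
  have hhi : exp (2 * 1.15) < 14 := by
    have : exp 1 ^ 5 < (2.72 : ℝ) ^ 5 := by gcongr; linarith
    have h14 : exp (2 * 1.25) < 14 := by
      refine lt_of_pow_lt_pow_left₀ 2 (by norm_num) ?_
      rw [e5]
      exact this.trans (by norm_num)
    exact lt_trans (exp_lt_exp.2 (by norm_num)) h14
  have h1 : coth 1.25 < 1.25 := by
    have := coth_mul_exp_sub_one (x := 1.25) (by norm_num)
    by_contra hc
    nlinarith
  have h2 : 1.15 < coth 1.15 := by
    have h0 := coth_mul_exp_sub_one (x := 1.15) (by norm_num)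
    have : 1 < exp (2 * 1.15) := one_lt_exp_iff.2 (by norm_num)
    by_contra hc
    nlinarith
  rw [abs_lt]
  constructor
  · by_contra hc
    have := coth_le_coth hτ (show τ ≤ 1.15 by norm_num at hc ⊢; linarith)
    norm_num at this h2 hc
    linarith
  · by_contra hc
    have := coth_le_coth (x := 1.25) (by norm_num) (show 1.25 ≤ τ by norm_num at hc ⊢; linarith)
    norm_num at this h1 hc
    linarith

/-! ### The quadratic equation of the first angular mode -/

/-- The smaller root of `μ² - (p + q) c μ + p q`. For `p`, `q` the reciprocals of the boundary
values of the conformal factor and `c = coth T` it is the eigenvalue `λ₁⁽¹⁾`. -/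
noncomputable def smallRoot (p q c : ℝ) : ℝ :=
  ((p + q) * c - √((p + q) ^ 2 * c ^ 2 - 4 * p * q)) / 2

section smallRoot

variable {p q c : ℝ}

theorem four_mul_le_sq_mul_sq (hp : 0 < p) (hq : 0 < q) (hc : 1 ≤ c) :
    0 ≤ (p + q) ^ 2 * c ^ 2 - 4 * p * q := by
  have h1 : (p + q) ^ 2 * 1 ≤ (p + q) ^ 2 * c ^ 2 := by
    gcongr
    exact one_le_pow₀ hc
  nlinarith [sq_nonneg (p - q)]

theorem smallRoot_isRoot (hp : 0 < p) (hq : 0 < q) (hc : 1 ≤ c) :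
    smallRoot p q c ^ 2 - (p + q) * c * smallRoot p q c + p * q = 0 := by
  have := sq_sqrt (four_mul_le_sq_mul_sq hp hq hc)
  unfold smallRoot
  linear_combination this / 4

theorem smallRoot_pos (hp : 0 < p) (hq : 0 < q) (hc : 1 ≤ c) : 0 < smallRoot p q c := by
  have h : √((p + q) ^ 2 * c ^ 2 - 4 * p * q) < (p + q) * c := by
    rw [sqrt_lt' (by positivity)]
    nlinarith [mul_pos hp hq]
  unfold smallRoot
  linarith

theorem smallRoot_le (hp : 0 < p) (hq : 0 < q) (hc : 1 ≤ c) {μ : ℝ}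
    (h : μ ^ 2 - (p + q) * c * μ + p * q ≤ 0) : smallRoot p q c ≤ μ := by
  have h0 := four_mul_le_sq_mul_sq hp hq hc
  have := abs_le_of_sq_le_sq' (a := 2 * μ - (p + q) * c)
    (by rw [sq_sqrt h0]; linarith) (sqrt_nonneg ((p + q) ^ 2 * c ^ 2 - 4 * p * q))
  unfold smallRoot
  linarith [this.1]

theorem smallRoot_lt (hp : 0 < p) (hq : 0 < q) (hc : 1 ≤ c) {μ : ℝ}
    (h : μ ^ 2 - (p + q) * c * μ + p * q < 0) : smallRoot p q c < μ :=
  (smallRoot_le hp hq hc h.le).lt_of_ne fun e => h.ne (e ▸ smallRoot_isRoot hp hq hc)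

theorem smallRoot_lt_smallRoot (hp : 0 < p) (hq : 0 < q) (hc : 1 ≤ c) {c' : ℝ} (hcc : c < c') :
    smallRoot p q c' < smallRoot p q c := by
  refine smallRoot_lt hp hq (hc.trans hcc.le) ?_
  have h := smallRoot_isRoot hp hq hc
  have : 0 < (p + q) * (c' - c) * smallRoot p q c :=
    mul_pos (mul_pos (by positivity) (sub_pos.2 hcc)) (smallRoot_pos hp hq hc)
  linarith

/-- As the product of the two roots is `p q`, a root with square at most `p q` is the smaller
one. -/
theorem eq_smallRoot (hp : 0 < p) (hq : 0 < q) (hc : 1 ≤ c) {μ : ℝ} (hμ : 0 < μ)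
    (h : μ ^ 2 - (p + q) * c * μ + p * q = 0) (hle : μ ^ 2 ≤ p * q) : μ = smallRoot p q c := by
  have h1 := smallRoot_le hp hq hc h.le
  have h2 := smallRoot_isRoot hp hq hc
  have h3 := smallRoot_pos hp hq hc
  by_contra hne
  have hlt : smallRoot p q c < μ := h1.lt_of_ne (Ne.symm hne)
  have h4 : (μ - smallRoot p q c) * (μ + smallRoot p q c - (p + q) * c) = 0 := by
    linear_combination h - h2
  rcases mul_eq_zero.1 h4 with h5 | h5
  · linarith
  · have : smallRoot p q c * μ = p * q := by
      rw [show (p + q) * c = μ + smallRoot p q c by linarith] at h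
      linarith
    nlinarith

end smallRoot

/-- The transition: for the boundary values `k t₁`, `k t₂` with `t₁ = coth (t₁ + a)` and
`t₂ = coth (t₂ - a)`, the rotationally invariant mode and the first angular mode have the same
eigenvalue at the modulus `t₁ + t₂`. -/
theorem smallRoot_transition {k t s a : ℝ} (hk : 0 < k) (ht : 0 < t) (hta : t = coth (t + a))
    (hs : 0 < s) (hsa : s = coth (s - a)) :
    smallRoot (k * t)⁻¹ (k * s)⁻¹ (coth (t + s)) = (k * t * s)⁻¹ := by
  have hx : 0 < t + a := coth_pos_iff.1 (hta ▸ ht)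
  have hy : 0 < s - a := coth_pos_iff.1 (hsa ▸ hs)
  have ht1 : 1 < t := hta ▸ one_lt_coth hx
  have hs1 : 1 < s := hsa ▸ one_lt_coth hy
  have hadd : coth (t + s) * (t + s) = 1 + t * s := by
    have h1 := coth_mul_sinh hx
    have h2 := coth_mul_sinh hy
    rw [← hta] at h1
    rw [← hsa] at h2
    have h3 := coth_mul_sinh (add_pos ht hs)
    have e : t + s = (t + a) + (s - a) := by ring
    have hS := sinh_pos_iff.2 hx
    have hS' := sinh_pos_iff.2 hy
    have h4 : sinh (t + s) = (t + s) * (sinh (t + a) * sinh (s - a)) := by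
      rw [e, sinh_add, ← h1, ← h2]; ring
    have h5 : cosh (t + s) = (1 + t * s) * (sinh (t + a) * sinh (s - a)) := by
      rw [e, cosh_add, ← h1, ← h2]; ring
    rw [h4, h5] at h3
    have h6 : sinh (t + a) * sinh (s - a) ≠ 0 := (mul_pos hS hS').ne'
    apply mul_right_cancel₀ h6
    linarith
  refine (eq_smallRoot (by positivity) (by positivity) (one_lt_coth (add_pos ht hs)).le
    (by positivity) ?_ ?_).symm
  · field_simp
    linarith
  · rw [← mul_inv, inv_pow]
    refine inv_anti₀ (by positivity) ?_
    have h1 : 1 ≤ t * s := one_le_mul_of_one_le_of_one_le ht1.le hs1.le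
    calc k * t * (k * s) = k ^ 2 * (t * s) * 1 := by ring
      _ ≤ k ^ 2 * (t * s) * (t * s) := by gcongr
      _ = (k * t * s) ^ 2 := by ring

/-! ### Functions on a strip and their Fourier coefficients -/

section strip

variable {a b : ℝ} {F : ℝ → ℝ → ℝ}

/-- The radial derivative, one-sided at the ends, of a function smooth up to the boundary is again
smooth up to the boundary. -/
theorem contDiffOn_derivWithin_strip (hab : a < b)
    (hF : ContDiffOn ℝ ∞ (fun p : ℝ × ℝ => F p.1 p.2) (Icc a b ×ˢ univ)) :
    ContDiffOn ℝ ∞ (fun p : ℝ × ℝ => derivWithin (fun s => F s p.2) (Icc a b) p.1)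
      (Icc a b ×ˢ univ) := by
  have hS : UniqueDiffOn ℝ (Icc a b ×ˢ (univ : Set ℝ)) :=
    (uniqueDiffOn_Icc hab).prod uniqueDiffOn_univ
  have h := (hF.fderivWithin hS (m := ∞) (by simp)).clm_apply
    (contDiffOn_const (c := ((1 : ℝ), (0 : ℝ))))
  refine h.congr fun p hp => ?_
  have h1 := ((hF.differentiableOn (by simp)) p hp).hasFDerivWithinAt
  have h2 : HasDerivWithinAt (fun s : ℝ => (s, p.2)) ((1 : ℝ), (0 : ℝ)) (Icc a b) p.1 :=
    (hasDerivWithinAt_id _ _).prodMk (hasDerivWithinAt_const _ _ _)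
  exact (h1.comp_hasDerivWithinAt (t := Icc a b ×ˢ univ) p.1 h2
    (fun s hs => ⟨hs, mem_univ _⟩)).derivWithin (uniqueDiffOn_Icc hab _ hp.1)

theorem continuousOn_integral_strip (hab : a ≤ b)
    (hF : ContinuousOn (fun p : ℝ × ℝ => F p.1 p.2) (Icc a b ×ˢ univ)) {w : ℝ → ℝ}
    (hw : Continuous w) (c d : ℝ) :
    ContinuousOn (fun r => ∫ θ in c..d, F r θ * w θ) (Icc a b) := by
  have h : Continuous (Function.uncurry fun r θ => F (projIcc a b hab r) θ * w θ) := by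
    refine Continuous.mul ?_ (hw.comp continuous_snd)
    exact hF.comp_continuous (f := fun p : ℝ × ℝ => ((projIcc a b hab p.1 : ℝ), p.2))
      (by fun_prop) fun p => ⟨Subtype.coe_prop _, mem_univ _⟩
  refine (intervalIntegral.continuous_parametric_intervalIntegral_of_continuous'
    (μ := MeasureTheory.volume) h c d).continuousOn.congr fun r hr => ?_
  simp only [projIcc_of_mem hab hr]

theorem hasDerivAt_integral_strip (hab : a < b)
    (hF : ContDiffOn ℝ ∞ (fun p : ℝ × ℝ => F p.1 p.2) (Icc a b ×ˢ univ)) {w : ℝ → ℝ}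
    (hw : Continuous w) (c d : ℝ) {r : ℝ} (hr : r ∈ Ioo a b) :
    HasDerivAt (fun r => ∫ θ in c..d, F r θ * w θ)
      (∫ θ in c..d, derivWithin (fun s => F s θ) (Icc a b) r * w θ) r := by
  have hF' := (contDiffOn_derivWithin_strip hab hF).continuousOn
  have hslice : ∀ {H : ℝ → ℝ → ℝ},
      ContinuousOn (fun p : ℝ × ℝ => H p.1 p.2) (Icc a b ×ˢ univ) →
      ∀ s ∈ Icc a b, Continuous fun θ => H s θ * w θ := fun hH s hs =>
    (hH.comp_continuous (f := fun θ : ℝ => (s, θ)) (by fun_prop) fun θ => ⟨hs, mem_univ _⟩).mul hw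
  have hI := Ioo_subset_Icc_self hr
  obtain ⟨C, hC⟩ := (isCompact_Icc.prod (isCompact_uIcc (a := c)
    (b := d))).exists_bound_of_continuousOn
    (f := fun p : ℝ × ℝ => derivWithin (fun s => F s p.2) (Icc a b) p.1 * w p.2)
    ((hF'.mul (hw.comp continuous_snd).continuousOn).mono (prod_mono le_rfl (subset_univ _)))
  refine (intervalIntegral.hasDerivAt_integral_of_dominated_loc_of_deriv_le
    (μ := MeasureTheory.volume) (bound := fun _ => C)
    (F' := fun r θ => derivWithin (fun s => F s θ) (Icc a b) r * w θ)
    (Ioo_mem_nhds hr.1 hr.2) ?_ ?_ ?_ ?_ ?_ ?_).2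
  · filter_upwards [Ioo_mem_nhds hr.1 hr.2] with s hs
    exact (hslice hF.continuousOn s (Ioo_subset_Icc_self hs)).aestronglyMeasurable
  · exact (hslice hF.continuousOn r hI).intervalIntegrable _ _
  · exact (hslice (H := fun s θ => derivWithin (fun s => F s θ) (Icc a b) s) hF' r
      hI).aestronglyMeasurable
  · exact Filter.Eventually.of_forall fun θ hθ s hs =>
      hC (s, θ) ⟨Ioo_subset_Icc_self hs, uIoc_subset_uIcc hθ⟩
  · exact intervalIntegrable_const
  · refine Filter.Eventually.of_forall fun θ _ s hs => ?_
    have hrad : ContDiffOn ℝ ∞ (fun s => F s θ) (Icc a b) :=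
      hF.comp (f := fun r : ℝ => (r, θ)) (by fun_prop) (fun r hr => ⟨hr, mem_univ _⟩)
    exact ((hrad.differentiableOn (by simp) s
      (Ioo_subset_Icc_self hs)).hasDerivWithinAt.hasDerivAt (Icc_mem_nhds hs.1 hs.2)).mul_const _

end strip

/-- Two integrations by parts over a period. -/
theorem integral_deriv_deriv_mul {f w w' : ℝ → ℝ} {ν : ℝ} (hf : ContDiff ℝ ∞ f)
    (hfp : Function.Periodic f (2 * π)) (hw : ∀ θ, HasDerivAt w (w' θ) θ)
    (hw' : ∀ θ, HasDerivAt w' (-ν ^ 2 * w θ) θ) (hwp : w (2 * π) = w 0)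
    (hwp' : w' (2 * π) = w' 0) :
    ∫ θ in (0 : ℝ)..2 * π, deriv (deriv f) θ * w θ = -ν ^ 2 * ∫ θ in (0 : ℝ)..2 * π, f θ * w θ := by
  have hf1 : ∀ θ, HasDerivAt f (deriv f θ) θ := fun θ =>
    (hf.differentiable (by simp) θ).hasDerivAt
  have hf' : ContDiff ℝ ∞ (deriv f) := ((contDiff_infty_iff_deriv).1 hf).2
  have hf2 : ∀ θ, HasDerivAt (deriv f) (deriv (deriv f) θ) θ := fun θ =>
    (hf'.differentiable (by simp) θ).hasDerivAt
  have hf'' : Continuous (deriv (deriv f)) := ((contDiff_infty_iff_deriv).1 hf').2.continuous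
  have hwc : Continuous w := continuous_iff_continuousAt.2 fun θ => (hw θ).continuousAt
  have e0 : f (2 * π) = f 0 := by simpa using hfp 0
  have e1 : deriv f (2 * π) = deriv f 0 := by
    have := deriv_comp_add_const f (2 * π) 0
    rw [show (fun x => f (x + 2 * π)) = f from funext hfp, zero_add] at this
    exact this.symm
  have hi1 : IntervalIntegrable (fun θ => deriv (deriv f) θ * w θ) MeasureTheory.volume 0 (2 * π) :=
    (hf''.mul hwc).intervalIntegrable _ _
  have hi2 : IntervalIntegrable (fun θ => -ν ^ 2 * (f θ * w θ)) MeasureTheory.volume 0 (2 * π) :=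
    (continuous_const.mul (hf.continuous.mul hwc)).intervalIntegrable _ _
  have := intervalIntegral.integral_eq_sub_of_hasDerivAt (a := 0) (b := 2 * π)
    (f := fun θ => deriv f θ * w θ - f θ * w' θ)
    (f' := fun θ => deriv (deriv f) θ * w θ - -ν ^ 2 * (f θ * w θ))
    (fun θ _ => (((hf2 θ).mul (hw θ)).sub ((hf1 θ).mul (hw' θ))).congr_deriv (by ring))
    (hi1.sub hi2)
  rw [intervalIntegral.integral_sub hi1 hi2, intervalIntegral.integral_const_mul] at this
  simp only [hwp, hwp', e0, e1, sub_self] at this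
  linarith

/-- A continuous periodic function is determined by its Fourier coefficients. -/
theorem eq_zero_of_fourier {f : ℝ → ℝ} (hf : Continuous f) (hp : Function.Periodic f (2 * π))
    (hc : ∀ n : ℕ, ∫ θ in (0 : ℝ)..2 * π, f θ * cos (n * θ) = 0)
    (hs : ∀ n : ℕ, ∫ θ in (0 : ℝ)..2 * π, f θ * sin (n * θ) = 0) : f = 0 := by
  have : Fact (0 < 2 * π) := ⟨two_pi_pos⟩
  have hp' : Function.Periodic (fun θ => (f θ : ℂ)) (2 * π) := fun θ => by simp only [hp θ]
  have hcont : Continuous hp'.lift := by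
    refine continuous_quot_lift _ ?_
    exact Complex.continuous_ofReal.comp hf
  let φ : C(AddCircle (2 * π), ℂ) := ⟨hp'.lift, hcont⟩
  have hcZ : ∀ n : ℤ, ∫ θ in (0 : ℝ)..2 * π, f θ * cos (n * θ) = 0 := by
    intro n
    obtain ⟨m, rfl | rfl⟩ := n.eq_nat_or_neg <;> simpa using hc m
  have hsZ : ∀ n : ℤ, ∫ θ in (0 : ℝ)..2 * π, f θ * sin (n * θ) = 0 := by
    intro n
    obtain ⟨m, rfl | rfl⟩ := n.eq_nat_or_neg <;> simpa using hs m
  have hcoef : ∀ n : ℤ, fourierCoeff φ n = 0 := by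
    intro n
    rw [fourierCoeff_eq_intervalIntegral φ n 0, zero_add]
    have : ∀ x : ℝ, (fourier (-n) (x : AddCircle (2 * π))) • φ (x : AddCircle (2 * π)) =
        ((f x * cos (n * x) : ℝ) : ℂ) - Complex.I * ((f x * sin (n * x) : ℝ) : ℂ) := by
      intro x
      have e : φ (x : AddCircle (2 * π)) = f x := rfl
      rw [e, fourier_coe_apply, smul_eq_mul]
      have : 2 * (π : ℂ) * Complex.I * ((-n : ℤ) : ℂ) * x / ((2 * π : ℝ) : ℂ) =
          ((-(n * x) : ℝ) : ℂ) * Complex.I := by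
        have : (π : ℂ) ≠ 0 := by exact_mod_cast pi_ne_zero
        push_cast
        field_simp
      rw [this, Complex.exp_mul_I, ← Complex.ofReal_cos, ← Complex.ofReal_sin, cos_neg, sin_neg]
      push_cast
      ring
    simp only [this]
    rw [intervalIntegral.integral_sub, intervalIntegral.integral_const_mul,
      intervalIntegral.integral_ofReal, intervalIntegral.integral_ofReal, hcZ, hsZ]
    · simp
    · exact Continuous.intervalIntegrable (by fun_prop) _ _
    · exact Continuous.intervalIntegrable (by fun_prop) _ _
  funext x
  have hsum := has_pointwise_sum_fourier_series_of_summable (f := φ)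
    (by simp only [funext hcoef]; exact summable_zero) (x : AddCircle (2 * π))
  simp only [hcoef, zero_smul] at hsum
  have : φ (x : AddCircle (2 * π)) = 0 := hsum.unique hasSum_zero
  exact Complex.ofReal_eq_zero.1 this

/-! ### Fourier modes of Steklov eigenfunctions -/

namespace RotMetric

variable (g : RotMetric)

theorem left_mem : g.r₁ ∈ Icc g.r₁ g.r₂ := left_mem_Icc.2 g.lt.le

theorem right_mem : g.r₂ ∈ Icc g.r₁ g.r₂ := right_mem_Icc.2 g.lt.le

theorem pos_G_left : 0 < g.G g.r₁ := g.pos_G _ g.left_mem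

theorem pos_G_right : 0 < g.G g.r₂ := g.pos_G _ g.right_mem

theorem contDiffOn_E_div_G : ContDiffOn ℝ ∞ (fun r => g.E r / g.G r) (Icc g.r₁ g.r₂) :=
  g.smooth_E.div g.smooth_G fun r hr => (g.pos_G r hr).ne'

/-- The conformal coordinate `t = ∫ E / G dr`, which runs from `0` to the modulus. -/
noncomputable def coordinate (r : ℝ) : ℝ := ∫ s in g.r₁..r, g.E s / g.G s

@[simp] theorem coordinate_left : g.coordinate g.r₁ = 0 := intervalIntegral.integral_same

@[simp] theorem coordinate_right : g.coordinate g.r₂ = g.modulus := rfl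

/-- The derivative is one-sided at the ends: `E` and `G` are only known on `[r₁, r₂]`. -/
theorem hasDerivWithinAt_coordinate {r : ℝ} (hr : r ∈ Icc g.r₁ g.r₂) :
    HasDerivWithinAt g.coordinate (g.E r / g.G r) (Icc g.r₁ g.r₂) r := by
  have hc : Continuous (IccExtend g.lt.le ((Icc g.r₁ g.r₂).domRestrict fun s => g.E s / g.G s)) :=
    (continuousOn_iff_continuous_domRestrict.1 g.contDiffOn_E_div_G.continuousOn).Icc_extend'
  have h := (hc.integral_hasStrictDerivAt g.r₁ r).hasDerivAt.hasDerivWithinAt (s := Icc g.r₁ g.r₂)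
  rw [IccExtend_of_mem _ _ hr] at h
  refine h.congr_of_mem (fun x hx => ?_) hr
  refine intervalIntegral.integral_congr fun s hs => ?_
  rw [uIcc_of_le hx.1] at hs
  rw [IccExtend_of_mem _ _ ⟨hs.1, hs.2.trans hx.2⟩]
  rfl

theorem contDiffOn_coordinate : ContDiffOn ℝ ∞ g.coordinate (Icc g.r₁ g.r₂) := by
  rw [contDiffOn_infty_iff_derivWithin (uniqueDiffOn_Icc g.lt)]
  exact ⟨fun r hr => (g.hasDerivWithinAt_coordinate hr).differentiableWithinAt,
    g.contDiffOn_E_div_G.congr fun r hr =>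
      (g.hasDerivWithinAt_coordinate hr).derivWithin (uniqueDiffOn_Icc g.lt r hr)⟩

theorem modulus_pos : 0 < g.modulus :=
  intervalIntegral.intervalIntegral_pos_of_pos_on
    (g.contDiffOn_E_div_G.continuousOn.intervalIntegrable_of_Icc g.lt.le)
    (fun r hr => div_pos (g.pos_E r (Ioo_subset_Icc_self hr)) (g.pos_G r (Ioo_subset_Icc_self hr)))
    g.lt

/-- The radial flux `(G / E) ∂_r u`, which is `∂_t u` in the conformal coordinate. -/
noncomputable def flux (u : ℝ → ℝ → ℝ) (r θ : ℝ) : ℝ :=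
  g.G r / g.E r * derivWithin (fun s => u s θ) (Icc g.r₁ g.r₂) r

variable {g}

theorem IsSmooth.contDiffOn_flux {u : ℝ → ℝ → ℝ} (hu : g.IsSmooth u) :
    ContDiffOn ℝ ∞ (fun p : ℝ × ℝ => g.flux u p.1 p.2) (Icc g.r₁ g.r₂ ×ˢ univ) := by
  have h : ContDiffOn ℝ ∞ (fun r => g.G r / g.E r) (Icc g.r₁ g.r₂) :=
    g.smooth_G.div g.smooth_E fun r hr => (g.pos_E r hr).ne'
  exact (h.comp (f := fun p : ℝ × ℝ => p.1) contDiff_fst.contDiffOn fun p hp => hp.1).mul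
    (contDiffOn_derivWithin_strip g.lt hu.contDiffOn)

theorem derivWithin_flux {u : ℝ → ℝ → ℝ} {r : ℝ} (hr : r ∈ Ioo g.r₁ g.r₂) {θ : ℝ}
    (h0 : g.laplacian u r θ = 0) :
    derivWithin (fun s => g.flux u s θ) (Icc g.r₁ g.r₂) r =
      -(g.E r / g.G r * deriv (deriv (u r)) θ) := by
  have hI := Ioo_subset_Icc_self hr
  have hE := g.pos_E r hI
  have hG := g.pos_G r hI
  rw [derivWithin_of_mem_nhds (Icc_mem_nhds hr.1 hr.2)]
  have : (fun s => g.flux u s θ) =ᶠ[nhds r]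
      fun ρ => g.G ρ / g.E ρ * deriv (fun s => u s θ) ρ := by
    filter_upwards [Ioo_mem_nhds hr.1 hr.2] with ρ hρ
    rw [flux, derivWithin_of_mem_nhds (Icc_mem_nhds hρ.1 hρ.2)]
  rw [this.deriv_eq]
  rcases mul_eq_zero.1 h0 with h | h
  · exact absurd h (inv_pos.2 (mul_pos hE hG)).ne'
  · linarith

/-- The system `dc/dt = P`, `dP/dt = ν² c` in the conformal coordinate has the first integral
`exp (ν t) (P - ν c)`. -/
theorem first_integral {c P : ℝ → ℝ} (ν : ℝ) (hc : ContinuousOn c (Icc g.r₁ g.r₂))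
    (hP : ContinuousOn P (Icc g.r₁ g.r₂))
    (hc' : ∀ r ∈ Ioo g.r₁ g.r₂, HasDerivAt c (g.E r / g.G r * P r) r)
    (hP' : ∀ r ∈ Ioo g.r₁ g.r₂, HasDerivAt P (g.E r / g.G r * (ν ^ 2 * c r)) r) :
    exp (ν * g.modulus) * (P g.r₂ - ν * c g.r₂) = P g.r₁ - ν * c g.r₁ := by
  have ht := g.contDiffOn_coordinate.continuousOn
  obtain ⟨r, -, hr⟩ := exists_hasDerivAt_eq_slope
    (fun r => exp (ν * g.coordinate r) * (P r - ν * c r)) (fun _ => 0) g.lt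
    ((continuous_exp.comp_continuousOn (continuousOn_const.mul ht)).mul
      (hP.sub (continuousOn_const.mul hc))) fun r hr => by
    have ht' := (g.hasDerivWithinAt_coordinate (Ioo_subset_Icc_self hr)).hasDerivAt
      (Icc_mem_nhds hr.1 hr.2)
    refine ((ht'.const_mul ν).exp.mul ((hP' r hr).sub ((hc' r hr).const_mul ν))).congr_deriv ?_
    simp only [Pi.sub_apply]
    ring
  have hne : g.r₂ - g.r₁ ≠ 0 := (sub_pos.2 g.lt).ne'
  rw [eq_comm, div_eq_zero_iff, or_iff_left hne] at hr
  simp only [coordinate_left, coordinate_right, mul_zero, exp_zero, one_mul] at hr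
  linarith

/-- For `ν = 0` the system of `first_integral` makes `c` affine in the conformal coordinate. -/
theorem affine_integral {c P : ℝ → ℝ} (hc : ContinuousOn c (Icc g.r₁ g.r₂))
    (hP : ContinuousOn P (Icc g.r₁ g.r₂))
    (hc' : ∀ r ∈ Ioo g.r₁ g.r₂, HasDerivAt c (g.E r / g.G r * P r) r)
    (hP' : ∀ r ∈ Ioo g.r₁ g.r₂, HasDerivAt P 0 r) :
    c g.r₂ - c g.r₁ = g.modulus * P g.r₂ := by
  have ht := g.contDiffOn_coordinate.continuousOn
  obtain ⟨r, -, hr⟩ := exists_hasDerivAt_eq_slope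
    (fun r => c r - g.coordinate r * P r) (fun _ => 0) g.lt (hc.sub (ht.mul hP)) fun r hr => by
    have ht' := (g.hasDerivWithinAt_coordinate (Ioo_subset_Icc_self hr)).hasDerivAt
      (Icc_mem_nhds hr.1 hr.2)
    exact ((hc' r hr).sub (ht'.mul (hP' r hr))).congr_deriv (by ring)
  have hne : g.r₂ - g.r₁ ≠ 0 := (sub_pos.2 g.lt).ne'
  rw [eq_comm, div_eq_zero_iff, or_iff_left hne] at hr
  simp only [coordinate_left, coordinate_right] at hr
  linarith

section mode

variable {u : ℝ → ℝ → ℝ} {w w' : ℝ → ℝ} {ν : ℝ}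

theorem hasDerivAt_mode (hu : g.IsSmooth u) (hw : Continuous w) {r : ℝ}
    (hr : r ∈ Ioo g.r₁ g.r₂) :
    HasDerivAt (fun r => ∫ θ in (0 : ℝ)..2 * π, u r θ * w θ)
      (g.E r / g.G r * ∫ θ in (0 : ℝ)..2 * π, g.flux u r θ * w θ) r := by
  refine (hasDerivAt_integral_strip g.lt hu.contDiffOn hw 0 (2 * π) hr).congr_deriv ?_
  rw [← intervalIntegral.integral_const_mul]
  refine intervalIntegral.integral_congr fun θ _ => ?_
  have hE := (g.pos_E r (Ioo_subset_Icc_self hr)).ne'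
  have hG := (g.pos_G r (Ioo_subset_Icc_self hr)).ne'
  simp only [flux]
  field_simp

theorem hasDerivAt_mode_flux (hu : g.IsSmooth u)
    (h0 : ∀ r ∈ Ioo g.r₁ g.r₂, ∀ θ, g.laplacian u r θ = 0) (hw : ∀ θ, HasDerivAt w (w' θ) θ)
    (hw' : ∀ θ, HasDerivAt w' (-ν ^ 2 * w θ) θ) (hwp : w (2 * π) = w 0)
    (hwp' : w' (2 * π) = w' 0) {r : ℝ} (hr : r ∈ Ioo g.r₁ g.r₂) :
    HasDerivAt (fun r => ∫ θ in (0 : ℝ)..2 * π, g.flux u r θ * w θ)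
      (g.E r / g.G r * (ν ^ 2 * ∫ θ in (0 : ℝ)..2 * π, u r θ * w θ)) r := by
  have hI := Ioo_subset_Icc_self hr
  have hwc : Continuous w := continuous_iff_continuousAt.2 fun θ => (hw θ).continuousAt
  refine (hasDerivAt_integral_strip g.lt hu.contDiffOn_flux hwc 0 (2 * π) hr).congr_deriv ?_
  have h1 := integral_deriv_deriv_mul (hu.angular hI) (hu.periodic r hI) hw hw' hwp hwp'
  calc _ = ∫ θ in (0 : ℝ)..2 * π, -(g.E r / g.G r) * (deriv (deriv (u r)) θ * w θ) := by
        refine intervalIntegral.integral_congr fun θ _ => ?_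
        simp only [derivWithin_flux hr (h0 r hr θ)]
        ring
    _ = _ := by
        rw [intervalIntegral.integral_const_mul, h1]
        ring

end mode

section eigenspace

variable {lam ν : ℝ} {φ : (ℝ → ℝ) × (ℝ → ℝ)} {w w' : ℝ → ℝ}

theorem continuous_of_mem_eigenspace (hφ : φ ∈ g.eigenspace lam) :
    (Continuous φ.1 ∧ Function.Periodic φ.1 (2 * π)) ∧
      (Continuous φ.2 ∧ Function.Periodic φ.2 (2 * π)) := by
  obtain ⟨u, hu, -, h1, h2, -, -⟩ := hφ
  rw [← (funext h1 : u g.r₁ = φ.1), ← (funext h2 : u g.r₂ = φ.2)]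
  exact ⟨⟨(hu.angular g.left_mem).continuous, hu.periodic _ g.left_mem⟩,
    ⟨(hu.angular g.right_mem).continuous, hu.periodic _ g.right_mem⟩⟩

/-- The two Steklov conditions at the ends, transported along the first integral, for the
Fourier coefficients of an eigenfunction with respect to `w'' = -ν² w`. -/
theorem mode_relation (hφ : φ ∈ g.eigenspace lam) (hw : ∀ θ, HasDerivAt w (w' θ) θ)
    (hw' : ∀ θ, HasDerivAt w' (-ν ^ 2 * w θ) θ) (hwp : w (2 * π) = w 0)
    (hwp' : w' (2 * π) = w' 0) :
    exp (ν * g.modulus) * ((lam * g.G g.r₂ - ν) * ∫ θ in (0 : ℝ)..2 * π, φ.2 θ * w θ) =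
        -((lam * g.G g.r₁ + ν) * ∫ θ in (0 : ℝ)..2 * π, φ.1 θ * w θ) ∧
      (ν = 0 → (∫ θ in (0 : ℝ)..2 * π, φ.2 θ * w θ) - (∫ θ in (0 : ℝ)..2 * π, φ.1 θ * w θ) =
        g.modulus * (lam * g.G g.r₂ * ∫ θ in (0 : ℝ)..2 * π, φ.2 θ * w θ)) := by
  obtain ⟨u, hu, h0, h1, h2, h3, h4⟩ := hφ
  have hwc : Continuous w := continuous_iff_continuousAt.2 fun θ => (hw θ).continuousAt
  have c0 := continuousOn_integral_strip g.lt.le hu.contDiffOn.continuousOn hwc 0 (2 * π)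
  have c1 := continuousOn_integral_strip g.lt.le hu.contDiffOn_flux.continuousOn hwc 0 (2 * π)
  have hd := fun r hr => hasDerivAt_mode (g := g) (r := r) hu hwc hr
  have hd' := fun r hr => hasDerivAt_mode_flux (g := g) (r := r) hu h0 hw hw' hwp hwp' hr
  have f1 : ∀ θ, g.flux u g.r₁ θ = -(lam * g.G g.r₁) * φ.1 θ := by
    intro θ
    have h := h3 θ
    simp only [innerConormalDeriv, Prod.smul_fst, Pi.smul_apply, smul_eq_mul] at h
    rw [flux, div_mul_eq_mul_div, div_eq_inv_mul]
    linear_combination -g.G g.r₁ * h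
  have f2 : ∀ θ, g.flux u g.r₂ θ = lam * g.G g.r₂ * φ.2 θ := by
    intro θ
    have h := h4 θ
    simp only [outerConormalDeriv, Prod.smul_snd, Pi.smul_apply, smul_eq_mul] at h
    rw [flux, div_mul_eq_mul_div, div_eq_inv_mul]
    linear_combination g.G g.r₂ * h
  constructor
  · have h := first_integral ν c0 c1 hd hd'
    simp only [h1, h2, f1, f2, mul_assoc, intervalIntegral.integral_const_mul] at h
    linear_combination h
  · rintro rfl
    have h := affine_integral c0 c1 hd fun r hr => (hd' r hr).congr_deriv (by ring)
    simp only [h1, h2, f2, mul_assoc, intervalIntegral.integral_const_mul] at h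
    linear_combination h

/-- A nonzero mean on the inner circle forces the eigenvalue `λ₀⁽²⁾`. -/
theorem eq_lambda02_of_mean (hφ : φ ∈ g.eigenspace lam) (hl : 0 < lam)
    (hne : ∫ θ in (0 : ℝ)..2 * π, φ.1 θ ≠ 0) : lam = g.lambda02 := by
  have h := mode_relation (w := fun _ => 1) (w' := fun _ => 0) (ν := 0) hφ
    (fun θ => hasDerivAt_const _ _) (fun θ => (hasDerivAt_const _ _).congr_deriv (by simp)) rfl rfl
  simp only [zero_mul, exp_zero, one_mul, sub_zero, add_zero, mul_one, forall_const] at h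
  obtain ⟨h1, h2⟩ := h
  have p1 := g.pos_G_left
  have p2 := g.pos_G_right
  have pT := g.modulus_pos
  set c1 := ∫ θ in (0 : ℝ)..2 * π, φ.1 θ
  set c2 := ∫ θ in (0 : ℝ)..2 * π, φ.2 θ
  have h3 : g.G g.r₂ * c2 = -(g.G g.r₁ * c1) := by
    apply mul_left_cancel₀ hl.ne'
    linear_combination h1
  have h4 : c1 * (lam * (g.G g.r₁ * g.G g.r₂ * g.modulus)) = c1 * (g.G g.r₁ + g.G g.r₂) := by
    linear_combination g.G g.r₂ * h2 - h3 + g.G g.r₂ * g.modulus * lam * h3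
  rw [lambda02, eq_div_iff (by positivity)]
  exact mul_left_cancel₀ hne h4

/-- An angular mode of order `ν ≥ 1` forces `λ ≥ ν λ₁⁽¹⁾`: the number `λ / ν`
solves the quadratic equation of `λ₁⁽¹⁾` with `ν T` in place of `T`, and
the smaller root of that equation increases with the modulus. -/
theorem lambda11_le_of_mode (hφ : φ ∈ g.eigenspace lam) (hl : 0 < lam)
    (hw : ∀ θ, HasDerivAt w (w' θ) θ) (hw' : ∀ θ, HasDerivAt w' (-ν ^ 2 * w θ) θ)
    (hwp : w (2 * π) = w 0) (hwp' : w' (2 * π) = w' 0) (hν : 1 ≤ ν)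
    (hne : ∫ θ in (0 : ℝ)..2 * π, φ.1 θ * w θ ≠ 0) : g.lambda11 ≤ lam / ν := by
  have h1 := (mode_relation hφ hw hw' hwp hwp').1
  have h2 := (mode_relation (ν := -ν) hφ hw (by simpa using hw') hwp hwp').1
  have p1 := g.pos_G_left
  have p2 := g.pos_G_right
  have pT := g.modulus_pos
  have pν : 0 < ν := one_pos.trans_le hν
  have hmul : exp (ν * g.modulus) * exp (-ν * g.modulus) = 1 := by
    rw [← exp_add]; simp
  have hsq : exp (2 * (ν * g.modulus)) = exp (ν * g.modulus) ^ 2 := by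
    rw [← exp_nat_mul]; norm_num
  have hX : 1 < exp (2 * (ν * g.modulus)) := one_lt_exp_iff.2 (by positivity)
  have hcoth := coth_mul_exp_sub_one (mul_pos pν pT)
  rw [hsq] at hX hcoth
  set c1 := ∫ θ in (0 : ℝ)..2 * π, φ.1 θ * w θ
  set c2 := ∫ θ in (0 : ℝ)..2 * π, φ.2 θ * w θ
  set X := exp (ν * g.modulus)
  set Y := exp (-ν * g.modulus)
  set f1 := g.G g.r₁
  set f2 := g.G g.r₂
  -- eliminating `c2` from the relations for `ν` and `-ν`
  have hdet : (lam * f1 + ν) * (lam * f2 + ν) - X ^ 2 * ((lam * f1 - ν) * (lam * f2 - ν)) = 0 := by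
    apply mul_left_cancel₀ hne
    linear_combination (lam * f2 + ν) * h1 - X ^ 2 * (lam * f2 - ν) * h2
      + X * (lam * f2 - ν) * (lam * f2 + ν) * c2 * hmul
  have hquad : (lam / ν) ^ 2 - (f1⁻¹ + f2⁻¹) * coth (ν * g.modulus) * (lam / ν) + f1⁻¹ * f2⁻¹
      = 0 := by
    have hX' : X ^ 2 - 1 ≠ 0 := (sub_pos.2 hX).ne'
    rw [show coth (ν * g.modulus) = (X ^ 2 + 1) / (X ^ 2 - 1) from
      (eq_div_iff hX').2 hcoth]
    field_simp
    linear_combination -hdet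
  refine smallRoot_le (inv_pos.2 p1) (inv_pos.2 p2) (one_lt_coth pT).le ?_
  rw [← hquad]
  have : coth (ν * g.modulus) ≤ coth g.modulus :=
    coth_le_coth pT (le_mul_of_one_le_left pT.le hν)
  gcongr

/-- The Fourier coefficients on the outer circle are determined by those on the inner one. -/
theorem mode_right_eq_zero (hφ : φ ∈ g.eigenspace lam) (hl : 0 < lam)
    (hw : ∀ θ, HasDerivAt w (w' θ) θ) (hw' : ∀ θ, HasDerivAt w' (-ν ^ 2 * w θ) θ)
    (hwp : w (2 * π) = w 0) (hwp' : w' (2 * π) = w' 0) (hν : 0 ≤ ν)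
    (h0 : ∫ θ in (0 : ℝ)..2 * π, φ.1 θ * w θ = 0) : ∫ θ in (0 : ℝ)..2 * π, φ.2 θ * w θ = 0 := by
  have h := (mode_relation (ν := -ν) hφ hw (by simpa using hw') hwp hwp').1
  rw [h0, mul_zero, neg_zero] at h
  have p2 := g.pos_G_right
  have : 0 < lam * g.G g.r₂ - -ν := by
    have := mul_pos hl p2
    linarith
  rwa [mul_eq_zero_iff_left (exp_pos _).ne', mul_eq_zero_iff_left this.ne'] at h

theorem sin_natCast_mul_two_pi (n : ℕ) : sin (n * (2 * π)) = 0 := by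
  simpa [mul_assoc, mul_comm, mul_left_comm] using sin_nat_mul_pi (2 * n)

theorem hasDerivAt_cos_mul (ν θ : ℝ) :
    HasDerivAt (fun θ => cos (ν * θ)) (-ν * sin (ν * θ)) θ :=
  ((hasDerivAt_id θ).const_mul ν).cos.congr_deriv (by simp; ring)

theorem hasDerivAt_sin_mul (ν θ : ℝ) :
    HasDerivAt (fun θ => sin (ν * θ)) (ν * cos (ν * θ)) θ :=
  ((hasDerivAt_id θ).const_mul ν).sin.congr_deriv (by simp; ring)

theorem eq_zero_of_modes (hφ : φ ∈ g.eigenspace lam) (hl : 0 < lam)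
    (hc : ∀ n : ℕ, ∫ θ in (0 : ℝ)..2 * π, φ.1 θ * cos (n * θ) = 0)
    (hs : ∀ n : ℕ, ∫ θ in (0 : ℝ)..2 * π, φ.1 θ * sin (n * θ) = 0) : φ = 0 := by
  obtain ⟨⟨c1, p1⟩, c2, p2⟩ := continuous_of_mem_eigenspace hφ
  refine Prod.ext (eq_zero_of_fourier c1 p1 hc hs) (eq_zero_of_fourier c2 p2 ?_ ?_)
  · intro n
    exact mode_right_eq_zero hφ hl (hasDerivAt_cos_mul n)
      (fun θ => ((hasDerivAt_sin_mul n θ).const_mul (-(n : ℝ))).congr_deriv (by ring))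
      (by simp [cos_nat_mul_two_pi]) (by simp [sin_natCast_mul_two_pi]) n.cast_nonneg (hc n)
  · intro n
    exact mode_right_eq_zero hφ hl (hasDerivAt_sin_mul n)
      (fun θ => ((hasDerivAt_cos_mul n θ).const_mul (n : ℝ)).congr_deriv (by ring))
      (by simp [sin_natCast_mul_two_pi]) (by simp [cos_nat_mul_two_pi]) n.cast_nonneg (hs n)

theorem lambda11_le_of_cos_or_sin (hφ : φ ∈ g.eigenspace lam) (hl : 0 < lam) {n : ℕ} (hn : 1 ≤ n)
    (hne : ∫ θ in (0 : ℝ)..2 * π, φ.1 θ * cos (n * θ) ≠ 0 ∨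
      ∫ θ in (0 : ℝ)..2 * π, φ.1 θ * sin (n * θ) ≠ 0) : g.lambda11 ≤ lam / n := by
  have hn' : (1 : ℝ) ≤ n := by exact_mod_cast hn
  rcases hne with h | h
  · exact lambda11_le_of_mode hφ hl (hasDerivAt_cos_mul n)
      (fun θ => ((hasDerivAt_sin_mul n θ).const_mul (-(n : ℝ))).congr_deriv (by ring))
      (by simp [cos_nat_mul_two_pi]) (by simp [sin_natCast_mul_two_pi]) hn' h
  · exact lambda11_le_of_mode hφ hl (hasDerivAt_sin_mul n)
      (fun θ => ((hasDerivAt_cos_mul n θ).const_mul (n : ℝ)).congr_deriv (by ring))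
      (by simp [sin_natCast_mul_two_pi]) (by simp [cos_nat_mul_two_pi]) hn' h

/-- By Fourier completeness an eigenfunction has a nonzero mode. Order `0` gives `λ = λ₀⁽²⁾`, a
higher order gives `λ ≥ λ₁⁽¹⁾`. -/
theorem min_le_of_mem_positiveEigenvalues (hl : lam ∈ g.positiveEigenvalues) :
    min g.lambda11 g.lambda02 ≤ lam := by
  obtain ⟨hl, hne⟩ := hl
  obtain ⟨φ, hφ, h0⟩ := (Submodule.ne_bot_iff _).1 hne
  by_contra! hlt
  rw [lt_min_iff] at hlt
  have key : ∀ n : ℕ, ∫ θ in (0 : ℝ)..2 * π, φ.1 θ * cos (n * θ) = 0 ∧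
      ∫ θ in (0 : ℝ)..2 * π, φ.1 θ * sin (n * θ) = 0 := by
    intro n
    rcases Nat.eq_zero_or_pos n with rfl | hn
    · by_contra h
      refine hlt.2.ne (eq_lambda02_of_mean hφ hl ?_)
      simpa using h
    · by_contra h
      have h1 := lambda11_le_of_cos_or_sin hφ hl hn (not_and_or.1 h)
      have h2 : lam / n ≤ lam := div_le_self hl.le (by exact_mod_cast hn)
      linarith [hlt.1]
  exact h0 (eq_zero_of_modes hφ hl (fun n => (key n).1) fun n => (key n).2)

/-- If `λ ≤ λ₁⁽¹⁾`, an element of the eigenspace is determined by the modes of order `0` and `1` on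
the inner circle. -/
theorem eq_zero_of_low_modes (hφ : φ ∈ g.eigenspace lam) (hl : 0 < lam) (hle : lam ≤ g.lambda11)
    (h0 : ∫ θ in (0 : ℝ)..2 * π, φ.1 θ = 0) (hc : ∫ θ in (0 : ℝ)..2 * π, φ.1 θ * cos θ = 0)
    (hs : ∫ θ in (0 : ℝ)..2 * π, φ.1 θ * sin θ = 0) : φ = 0 := by
  have key : ∀ n : ℕ, ∫ θ in (0 : ℝ)..2 * π, φ.1 θ * cos (n * θ) = 0 ∧
      ∫ θ in (0 : ℝ)..2 * π, φ.1 θ * sin (n * θ) = 0 := by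
    intro n
    rcases Nat.lt_or_ge n 2 with h | hn
    · interval_cases n
      · simpa using h0
      · simpa using ⟨hc, hs⟩
    · by_contra h
      have h1 := lambda11_le_of_cos_or_sin hφ hl (by omega) (not_and_or.1 h)
      have h2 : lam / n < lam := div_lt_self hl (by exact_mod_cast hn)
      linarith
  exact eq_zero_of_modes hφ hl (fun n => (key n).1) fun n => (key n).2

end eigenspace

end RotMetric

/-! ### Separated eigenfunctions and the first eigenvalue -/

namespace RotMetric

variable {g : RotMetric}

/-- A product `h(t) w(θ)` with `h'' = ν² h`, `w'' = -ν² w` is harmonic. If `h` satisfies the Steklov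
conditions at both ends, then its boundary values lie in the eigenspace. -/
theorem separated_mem_eigenspace {h h' w w' : ℝ → ℝ} {ν lam : ℝ} (hh : ContDiff ℝ ∞ h)
    (hw : ContDiff ℝ ∞ w) (hp : Function.Periodic w (2 * π)) (h1 : ∀ t, HasDerivAt h (h' t) t)
    (h2 : ∀ t, HasDerivAt h' (ν ^ 2 * h t) t) (w1 : ∀ θ, HasDerivAt w (w' θ) θ)
    (w2 : ∀ θ, HasDerivAt w' (-ν ^ 2 * w θ) θ) (hl : h' 0 = -(lam * g.G g.r₁ * h 0))
    (hr : h' g.modulus = lam * g.G g.r₂ * h g.modulus) :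
    ((fun θ => h 0 * w θ, fun θ => h g.modulus * w θ) : (ℝ → ℝ) × (ℝ → ℝ)) ∈
      g.eigenspace lam := by
  have hdw : ∀ r ∈ Icc g.r₁ g.r₂, ∀ θ, HasDerivWithinAt (fun s => h (g.coordinate s) * w θ)
      (h' (g.coordinate r) * (g.E r / g.G r) * w θ) (Icc g.r₁ g.r₂) r := fun r hr θ =>
    ((h1 _).comp_hasDerivWithinAt r (g.hasDerivWithinAt_coordinate hr)).mul_const _
  refine ⟨fun r θ => h (g.coordinate r) * w θ, ⟨?_, ?_⟩, ?_, ?_, ?_, ?_, ?_⟩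
  · refine ContDiffOn.mul ?_ (hw.comp contDiff_snd).contDiffOn
    exact hh.comp_contDiffOn (g.contDiffOn_coordinate.comp (f := fun p : ℝ × ℝ => p.1)
      contDiff_fst.contDiffOn fun p hp => hp.1)
  · intro r _ θ
    simp only [hp θ]
  · intro r hr θ
    have hE := (g.pos_E r (Ioo_subset_Icc_self hr)).ne'
    have hG := (g.pos_G r (Ioo_subset_Icc_self hr)).ne'
    have hflux : (fun ρ => g.G ρ / g.E ρ * deriv (fun s => h (g.coordinate s) * w θ) ρ) =ᶠ[nhds r]
        fun ρ => h' (g.coordinate ρ) * w θ := by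
      filter_upwards [Ioo_mem_nhds hr.1 hr.2] with ρ hρ
      have hE := (g.pos_E ρ (Ioo_subset_Icc_self hρ)).ne'
      have hG := (g.pos_G ρ (Ioo_subset_Icc_self hρ)).ne'
      rw [((hdw ρ (Ioo_subset_Icc_self hρ) θ).hasDerivAt (Icc_mem_nhds hρ.1 hρ.2)).deriv]
      field_simp
    have hd : HasDerivAt (fun ρ => h' (g.coordinate ρ) * w θ)
        (ν ^ 2 * h (g.coordinate r) * (g.E r / g.G r) * w θ) r :=
      ((h2 _).comp r ((g.hasDerivWithinAt_coordinate (Ioo_subset_Icc_self hr)).hasDerivAt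
        (Icc_mem_nhds hr.1 hr.2))).mul_const _
    have hang : deriv (fun θ => h (g.coordinate r) * w θ) =
        fun θ => h (g.coordinate r) * w' θ := funext fun θ => ((w1 θ).const_mul _).deriv
    rw [laplacian, hflux.deriv_eq, hd.deriv, hang, ((w2 θ).const_mul _).deriv]
    ring
  · simp
  · simp
  · intro θ
    have hE := (g.pos_E _ g.left_mem).ne'
    have hG := g.pos_G_left.ne'
    rw [innerConormalDeriv,
      (hdw _ g.left_mem θ).derivWithin (uniqueDiffOn_Icc g.lt _ g.left_mem)]
    simp only [coordinate_left, hl, Prod.smul_fst, Pi.smul_apply, smul_eq_mul]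
    field_simp
  · intro θ
    have hE := (g.pos_E _ g.right_mem).ne'
    have hG := g.pos_G_right.ne'
    rw [outerConormalDeriv,
      (hdw _ g.right_mem θ).derivWithin (uniqueDiffOn_Icc g.lt _ g.right_mem)]
    simp only [coordinate_right, hr, Prod.smul_snd, Pi.smul_apply, smul_eq_mul]
    field_simp

theorem lambda02_pos (g : RotMetric) : 0 < g.lambda02 := by
  have := g.pos_G_left
  have := g.pos_G_right
  have := g.modulus_pos
  unfold lambda02
  positivity

theorem lambda11_pos (g : RotMetric) : 0 < g.lambda11 :=
  smallRoot_pos (inv_pos.2 g.pos_G_left) (inv_pos.2 g.pos_G_right) (one_lt_coth g.modulus_pos).le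

theorem exists_rotational_mem_eigenspace (g : RotMetric) :
    ∃ b : ℝ, ((fun _ => 1, fun _ => b) : (ℝ → ℝ) × (ℝ → ℝ)) ∈ g.eigenspace g.lambda02 := by
  have p1 := g.pos_G_left
  have p2 := g.pos_G_right
  have pT := g.modulus_pos
  refine ⟨1 - g.lambda02 * g.G g.r₁ * g.modulus, ?_⟩
  have := separated_mem_eigenspace (g := g) (h := fun t => 1 - g.lambda02 * g.G g.r₁ * t)
    (h' := fun _ => -(g.lambda02 * g.G g.r₁)) (w := fun _ => 1) (w' := fun _ => 0) (ν := 0)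
    (lam := g.lambda02) (by fun_prop) contDiff_const (fun _ => rfl)
    (fun t => (((hasDerivAt_id t).const_mul _).const_sub _).congr_deriv (by simp))
    (fun t => (hasDerivAt_const _ _).congr_deriv (by simp)) (fun θ => hasDerivAt_const _ _)
    (fun θ => (hasDerivAt_const _ _).congr_deriv (by simp)) (by simp)
    (by simp only [lambda02]; field_simp; ring)
  simpa using this

/-- The function `h(t) = cosh t - λ G(r₁) sinh t` satisfies the inner Steklov condition for every
`λ`, and the outer one exactly if `λ` solves the quadratic equation of `λ₁⁽¹⁾`. -/
theorem exists_angular_mem_eigenspace (g : RotMetric) :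
    ∃ b : ℝ, ((cos, fun θ => b * cos θ) : (ℝ → ℝ) × (ℝ → ℝ)) ∈ g.eigenspace g.lambda11 ∧
      ((sin, fun θ => b * sin θ) : (ℝ → ℝ) × (ℝ → ℝ)) ∈ g.eigenspace g.lambda11 := by
  have p1 := g.pos_G_left
  have p2 := g.pos_G_right
  have pT := sinh_pos_iff.2 g.modulus_pos
  set l := g.lambda11
  let h : ℝ → ℝ := fun t => cosh t - l * g.G g.r₁ * sinh t
  let h' : ℝ → ℝ := fun t => sinh t - l * g.G g.r₁ * cosh t
  have hh : ContDiff ℝ ∞ h := contDiff_cosh.sub (contDiff_const.mul contDiff_sinh)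
  have hd1 : ∀ t, HasDerivAt h (h' t) t := fun t =>
    (hasDerivAt_cosh t).sub ((hasDerivAt_sinh t).const_mul _)
  have hd2 : ∀ t, HasDerivAt h' (1 ^ 2 * h t) t := fun t =>
    ((hasDerivAt_sinh t).sub ((hasDerivAt_cosh t).const_mul _)).congr_deriv (by simp [h])
  have h0 : h' 0 = -(l * g.G g.r₁ * h 0) := by simp [h, h']
  have hroot : h' g.modulus = l * g.G g.r₂ * h g.modulus := by
    have := smallRoot_isRoot (inv_pos.2 p1) (inv_pos.2 p2) (one_lt_coth g.modulus_pos).le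
    rw [show smallRoot (g.G g.r₁)⁻¹ (g.G g.r₂)⁻¹ (coth g.modulus) = l from rfl, coth] at this
    field_simp at this
    simp only [h, h']
    linear_combination this
  have hc := separated_mem_eigenspace (g := g) (w := cos) (w' := fun θ => -sin θ) hh
    contDiff_cos cos_periodic hd1 hd2 hasDerivAt_cos
    (fun θ => (hasDerivAt_sin θ).neg.congr_deriv (by simp)) h0 hroot
  have hs := separated_mem_eigenspace (g := g) (w := sin) (w' := cos) hh
    contDiff_sin sin_periodic hd1 hd2 hasDerivAt_sin
    (fun θ => (hasDerivAt_cos θ).congr_deriv (by simp)) h0 hroot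
  have e : h 0 = 1 := by simp [h]
  simp only [e, one_mul] at hc hs
  exact ⟨h g.modulus, hc, hs⟩

theorem isLeast_positiveEigenvalues (g : RotMetric) :
    IsLeast g.positiveEigenvalues (min g.lambda11 g.lambda02) := by
  refine ⟨?_, fun l hl => min_le_of_mem_positiveEigenvalues hl⟩
  have h1 : g.lambda11 ∈ g.positiveEigenvalues := by
    obtain ⟨b, hb, -⟩ := g.exists_angular_mem_eigenspace
    refine ⟨g.lambda11_pos, (Submodule.ne_bot_iff _).2 ⟨_, hb, fun h => ?_⟩⟩
    simpa using congr_fun (congr_arg Prod.fst h) 0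
  have h2 : g.lambda02 ∈ g.positiveEigenvalues := by
    obtain ⟨b, hb⟩ := g.exists_rotational_mem_eigenspace
    refine ⟨g.lambda02_pos, (Submodule.ne_bot_iff _).2 ⟨_, hb, fun h => ?_⟩⟩
    simpa using congr_fun (congr_arg Prod.fst h) 0
  rcases min_choice g.lambda11 g.lambda02 with h | h <;> rw [h] <;> assumption

theorem sigma1_eq_min (g : RotMetric) : g.sigma1 = min g.lambda11 g.lambda02 :=
  g.isLeast_positiveEigenvalues.csInf_eq

/-- If the two candidates coincide, the rotationally invariant eigenfunction and the two angular
ones of order `1` form a basis of the eigenspace. -/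
theorem sigma1Multiplicity_eq_three (h : g.lambda11 = g.lambda02) :
    g.sigma1Multiplicity = 3 := by
  have hs : g.sigma1 = g.lambda11 := by rw [sigma1_eq_min, ← h, min_self]
  rw [sigma1Multiplicity, hs]
  obtain ⟨b, hb⟩ := g.exists_rotational_mem_eigenspace
  rw [← h] at hb
  obtain ⟨d, hc, hs⟩ := g.exists_angular_mem_eigenspace
  let v : Fin 3 → g.eigenspace g.lambda11 := ![⟨_, hb⟩, ⟨_, hc⟩, ⟨_, hs⟩]
  have hv : ∀ x : Fin 3 → ℝ, ∀ θ, ((∑ i, x i • v i : g.eigenspace g.lambda11).1).1 θ =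
      x 0 + x 1 * cos θ + x 2 * sin θ := by
    intro x θ
    simp [v, Fin.sum_univ_three]
  have hli : LinearIndependent ℝ v := by
    rw [Fintype.linearIndependent_iff]
    intro x hx
    have hx' : ∀ θ, x 0 + x 1 * cos θ + x 2 * sin θ = 0 := fun θ => by
      rw [← hv, hx]; rfl
    -- the values of the first component at three angles separate the coefficients
    have e1 := hx' 0
    have e2 := hx' π
    have e3 := hx' (π / 2)
    simp at e1 e2 e3
    intro i
    fin_cases i <;> simp <;> linarith
  have hspan : ⊤ ≤ Submodule.span ℝ (range v) := by
    intro φ _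
    -- subtract the combination with the same Fourier coefficients of order at most `1`
    have hφc := (continuous_of_mem_eigenspace φ.2).1.1
    let x : Fin 3 → ℝ := ![(∫ θ in (0 : ℝ)..2 * π, φ.1.1 θ) / (2 * π),
      (∫ θ in (0 : ℝ)..2 * π, φ.1.1 θ * cos θ) / π, (∫ θ in (0 : ℝ)..2 * π, φ.1.1 θ * sin θ) / π]
    have hint : ∀ w : ℝ → ℝ, Continuous w →
        ∫ θ in (0 : ℝ)..2 * π, (φ - ∑ i, x i • v i : g.eigenspace g.lambda11).1.1 θ * w θ =
        (∫ θ in (0 : ℝ)..2 * π, φ.1.1 θ * w θ) - ((x 0 * ∫ θ in (0 : ℝ)..2 * π, w θ) +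
          (x 1 * ∫ θ in (0 : ℝ)..2 * π, cos θ * w θ) +
          (x 2 * ∫ θ in (0 : ℝ)..2 * π, sin θ * w θ)) := by
      intro w hw
      have hii : ∀ {f : ℝ → ℝ}, Continuous f →
          IntervalIntegrable f MeasureTheory.volume 0 (2 * π) := fun hf => hf.intervalIntegrable _ _
      have i0 := hii (f := fun θ => φ.1.1 θ * w θ) (by fun_prop)
      have i1 := hii (f := fun θ => x 0 * w θ) (by fun_prop)
      have i2 := hii (f := fun θ => x 1 * (cos θ * w θ)) (by fun_prop)
      have i12 := hii (f := fun θ => x 0 * w θ + x 1 * (cos θ * w θ)) (by fun_prop)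
      have i3 := hii (f := fun θ => x 2 * (sin θ * w θ)) (by fun_prop)
      have i123 := hii (f := fun θ => x 0 * w θ + x 1 * (cos θ * w θ) + x 2 * (sin θ * w θ))
        (by fun_prop)
      rw [← intervalIntegral.integral_const_mul, ← intervalIntegral.integral_const_mul,
        ← intervalIntegral.integral_const_mul, ← intervalIntegral.integral_add i1 i2,
        ← intervalIntegral.integral_add i12 i3,
        ← intervalIntegral.integral_sub i0 i123]
      refine intervalIntegral.integral_congr fun θ _ => ?_
      have e : (φ - ∑ i, x i • v i : g.eigenspace g.lambda11).1.1 θ =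
          φ.1.1 θ - (∑ i, x i • v i : g.eigenspace g.lambda11).1.1 θ := rfl
      simp only [e, hv]
      ring
    have hpi := pi_ne_zero
    have hsc : ∫ θ in (0 : ℝ)..2 * π, sin θ * cos θ = 0 := by simp [integral_sin_mul_cos₁]
    have hcs : ∫ θ in (0 : ℝ)..2 * π, cos θ * sin θ = 0 := by simpa only [mul_comm] using hsc
    have hcc : ∫ θ in (0 : ℝ)..2 * π, cos θ * cos θ = π := by
      simp only [← pow_two, integral_cos_sq]; simp
    have hss : ∫ θ in (0 : ℝ)..2 * π, sin θ * sin θ = π := by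
      simp only [← pow_two, integral_sin_sq]; simp
    have h0 : (φ - ∑ i, x i • v i : g.eigenspace g.lambda11).1 = 0 := by
      refine eq_zero_of_low_modes (Subtype.coe_prop _) g.lambda11_pos le_rfl ?_ ?_ ?_
      · have := hint (fun _ => 1) continuous_const
        simp only [mul_one] at this
        rw [this]
        simp [x]
      · rw [hint _ continuous_cos, hcc, hsc]
        simp [x]
      · rw [hint _ continuous_sin, hcs, hss]
        simp [x]
    rw [sub_eq_zero.1 (Subtype.ext h0)]
    exact Submodule.sum_mem _ fun i _ =>
      Submodule.smul_mem _ _ (Submodule.subset_span (mem_range_self i))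
  simpa using Module.finrank_eq_card_basis (Module.Basis.mk hli hspan)

/-- Conformal factors interpolating linearly realize all boundary values and moduli. -/
theorem exists_metric {x y T : ℝ} (hx : 0 < x) (hy : 0 < y) (hT : 0 < T) :
    ∃ g : RotMetric, g.G g.r₁ = x ∧ g.G g.r₂ = y ∧ g.modulus = T := by
  have hpos : ∀ r ∈ Icc 0 T, 0 < x * (1 - r / T) + y * (r / T) := by
    intro r hr
    have h1 : 0 ≤ r / T := div_nonneg hr.1 hT.le
    have h2 : r / T ≤ 1 := (div_le_one hT).2 hr.2
    rcases h1.eq_or_lt with h | h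
    · simpa [← h] using hx
    · have := mul_pos hy h
      have := mul_nonneg hx.le (sub_nonneg.2 h2)
      linarith
  have hs : ContDiff ℝ ∞ fun r : ℝ => x * (1 - r / T) + y * (r / T) := by fun_prop
  refine ⟨⟨0, T, hT, _, _, hs.contDiffOn, hs.contDiffOn, hpos, hpos⟩, by simp,
    by simp [hT.ne'], ?_⟩
  have : ∫ r in (0 : ℝ)..T, (x * (1 - r / T) + y * (r / T)) / (x * (1 - r / T) + y * (r / T)) =
      ∫ r in (0 : ℝ)..T, 1 := by
    refine intervalIntegral.integral_congr fun r hr => ?_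
    rw [uIcc_of_le hT.le] at hr
    exact div_self (hpos r hr).ne'
  simpa [modulus] using this

theorem ratio_eq (g : RotMetric) : g.ratio = g.G g.r₁ / g.G g.r₂ :=
  mul_div_mul_left _ _ two_pi_pos.ne'

theorem ratio_pos (g : RotMetric) : 0 < g.ratio :=
  g.ratio_eq ▸ div_pos g.pos_G_left g.pos_G_right

end RotMetric

/-! ### Optimal modulus and optimal ratio -/

section ratio

variable {t s a : ℝ}

/-- For a fixed ratio of the boundary lengths `λ₁⁽¹⁾` increases and `λ₀⁽²⁾` decreases with the
modulus. They meet at the value `m` for the modulus `t + s`. -/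
theorem RotMetric.eigenvalue_crossing (ht : 0 < t) (hta : t = coth (t + a)) (hs : 0 < s)
    (hsa : s = coth (s - a)) {g : RotMetric} (hr : g.ratio = t / s) :
    ∃ m, m * g.boundaryLength = 2 * π * (t⁻¹ + s⁻¹) ∧
      (g.modulus < t + s → g.lambda11 < m ∧ m < g.lambda02) ∧
      (g.modulus = t + s → g.lambda11 = m ∧ g.lambda02 = m) ∧
      (t + s < g.modulus → g.lambda02 < m ∧ m < g.lambda11) := by
  have p1 := g.pos_G_left
  have p2 := g.pos_G_right
  have pT := g.modulus_pos
  have pS := add_pos ht hs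
  have hk : 0 < g.G g.r₂ / s := div_pos p2 hs
  set k := g.G g.r₂ / s with hkdef
  have h2 : g.G g.r₂ = k * s := by rw [hkdef]; field_simp
  have h1 : g.G g.r₁ = k * t := by
    rw [g.ratio_eq, div_eq_iff p2.ne', h2] at hr
    rw [hr]; field_simp
  have h11 : g.lambda11 = smallRoot (k * t)⁻¹ (k * s)⁻¹ (coth g.modulus) := by
    rw [← h1, ← h2]; rfl
  have h02 : g.lambda02 = (k * t * s)⁻¹ * ((t + s) / g.modulus) := by
    rw [RotMetric.lambda02, h1, h2]; field_simp
  have hm : 0 < (k * t * s)⁻¹ := by positivity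
  have htr := smallRoot_transition hk ht hta hs hsa
  have q1 : 0 < (k * t)⁻¹ := by positivity
  have q2 : 0 < (k * s)⁻¹ := by positivity
  refine ⟨(k * t * s)⁻¹, ?_, fun h => ?_, fun h => ?_, fun h => ?_⟩
  · rw [RotMetric.boundaryLength, RotMetric.innerLength, RotMetric.outerLength, h1, h2]
    field_simp
    ring
  · constructor
    · rw [h11, ← htr]
      exact smallRoot_lt_smallRoot q1 q2 (one_lt_coth pS).le (coth_lt_coth pT h)
    · rw [h02]
      exact lt_mul_of_one_lt_right hm ((one_lt_div pT).2 h)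
  · rw [h11, h02, h, div_self pS.ne', mul_one]
    exact ⟨htr, rfl⟩
  · constructor
    · rw [h02]
      exact mul_lt_of_lt_one_right hm ((div_lt_one pT).2 h)
    · rw [h11, ← htr]
      exact smallRoot_lt_smallRoot q1 q2 (one_lt_coth pT).le (coth_lt_coth pS h)

theorem RotMetric.boundaryLength_pos (g : RotMetric) : 0 < g.boundaryLength :=
  add_pos (mul_pos two_pi_pos g.pos_G_left) (mul_pos two_pi_pos g.pos_G_right)

theorem RotMetric.sigma1L_le_of_ratio (ht : 0 < t) (hta : t = coth (t + a)) (hs : 0 < s)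
    (hsa : s = coth (s - a)) {g : RotMetric} (hr : g.ratio = t / s) :
    g.sigma1L ≤ 2 * π * (t⁻¹ + s⁻¹) ∧
      (g.sigma1L = 2 * π * (t⁻¹ + s⁻¹) ↔ g.modulus = t + s) ∧
      (g.modulus = t + s → g.lambda11 = g.lambda02) := by
  obtain ⟨m, hm, hlt, heq, hgt⟩ := g.eigenvalue_crossing ht hta hs hsa hr
  have hL := g.boundaryLength_pos
  rw [← hm, RotMetric.sigma1L, RotMetric.sigma1_eq_min, mul_le_mul_iff_left₀ hL,
    mul_left_inj' hL.ne']
  rcases lt_trichotomy g.modulus (t + s) with h | h | h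
  · obtain ⟨e1, e2⟩ := hlt h
    have : min g.lambda11 g.lambda02 < m := min_lt_of_left_lt e1
    exact ⟨this.le, ⟨fun e => absurd e this.ne, fun e => absurd e h.ne⟩, fun e => absurd e h.ne⟩
  · obtain ⟨e1, e2⟩ := heq h
    rw [e1, e2, min_self]
    exact ⟨le_rfl, ⟨fun _ => h, fun _ => rfl⟩, fun _ => rfl⟩
  · obtain ⟨e1, e2⟩ := hgt h
    have : min g.lambda11 g.lambda02 < m := min_lt_of_right_lt e1
    exact ⟨this.le, ⟨fun e => absurd e this.ne, fun e => absurd e h.ne'⟩, fun e => absurd e h.ne'⟩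

theorem RotMetric.exists_metric_of_ratio (ht : 0 < t) (hs : 0 < s) {T : ℝ} (hT : 0 < T) :
    ∃ g : RotMetric, g.ratio = t / s ∧ g.modulus = T := by
  obtain ⟨g, h1, h2, h3⟩ := RotMetric.exists_metric ht hs hT
  exact ⟨g, by rw [g.ratio_eq, h1, h2], h3⟩

theorem isTransitionModulus_iff (ht : 0 < t) (hta : t = coth (t + a)) (hs : 0 < s)
    (hsa : s = coth (s - a)) (T : ℝ) : IsTransitionModulus (t / s) T ↔ T = t + s := by
  have pS := add_pos ht hs
  constructor
  · rintro ⟨hT, h⟩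
    -- a metric with modulus strictly between `T` and `t + s` would have the wrong `σ₁`
    obtain ⟨g, hr, hg⟩ := RotMetric.exists_metric_of_ratio ht hs
      (show 0 < (T + (t + s)) / 2 by positivity)
    obtain ⟨m, -, hlt, -, hgt⟩ := g.eigenvalue_crossing ht hta hs hsa hr
    obtain ⟨hle, hge⟩ := h g hr
    rw [g.sigma1_eq_min] at hle hge
    rcases lt_trichotomy T (t + s) with h | h | h
    · have e1 := hlt (by linarith)
      have e2 := hge (by linarith)
      rw [min_eq_left (e1.1.trans e1.2).le] at e2
      linarith
    · exact h
    · have e1 := hgt (by linarith)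
      have e2 := hle (by linarith)
      rw [min_eq_right (e1.1.trans e1.2).le] at e2
      linarith
  · rintro rfl
    refine ⟨pS, fun g hr => ?_⟩
    obtain ⟨m, -, hlt, heq, hgt⟩ := g.eigenvalue_crossing ht hta hs hsa hr
    rw [g.sigma1_eq_min]
    refine ⟨fun h => min_eq_left ?_, fun h => min_eq_right ?_⟩
    · rcases h.lt_or_eq with h | h
      · exact ((hlt h).1.trans (hlt h).2).le
      · rw [(heq h).1, (heq h).2]
    · rcases h.lt_or_eq with h | h
      · exact ((hgt h).1.trans (hgt h).2).le
      · rw [(heq h.symm).1, (heq h.symm).2]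

/-- The maximum for a given ratio is largest for the ratio `1`. Both sides are reciprocals of the
Langevin function, at the moduli `t + s` and `2 τ`. -/
theorem inv_add_inv_lt {τ : ℝ} (hτ : 0 < τ) (hτc : τ = coth τ) (ht : 0 < t)
    (hta : t = coth (t + a)) (hs : 0 < s) (hsa : s = coth (s - a)) (ha : a ≠ 0) :
    t⁻¹ + s⁻¹ < 2 / τ := by
  have hx : 0 < t + a := coth_pos_iff.1 (hta ▸ ht)
  have hy : 0 < s - a := coth_pos_iff.1 (hsa ▸ hs)
  have hxy : t + a + (s - a) = coth (t + a) + coth (s - a) := by rw [← hta, ← hsa]; ring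
  have hne : t + a ≠ s - a := by
    intro e
    have : t = s := by rw [hta, hsa, e]
    exact ha (by linarith)
  have h1 := inv_coth_add_inv_coth hx hy hxy
  have h2 := inv_coth_add_inv_coth hτ hτ (by rw [← hτc])
  rw [← hta, ← hsa] at h1
  rw [← hτc] at h2
  have hlt : τ < (t + a + (s - a)) / 2 :=
    lt_of_coth_lt_self hτc (coth_half_lt hx hy hne hxy) (by positivity)
  have hmono := strictMonoOn_langevin (show τ + τ ∈ Ioi 0 from add_pos hτ hτ)
    (show t + a + (s - a) ∈ Ioi 0 from add_pos hx hy) (by linarith)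
  have hpos : 0 < coth (τ + τ) - (τ + τ)⁻¹ := by
    rw [← inv_pos, ← h2]
    positivity
  rw [h1, show 2 / τ = τ⁻¹ + τ⁻¹ by ring, h2]
  exact inv_strictAnti₀ hpos hmono

end ratio

section range

variable {t₁ t₂ : ℝ → ℝ}

theorem fixedPoint_strictAnti (h₁ : ∀ a, 0 < t₁ a ∧ t₁ a = coth (t₁ a + a)) : StrictAnti t₁ :=
  fun a b hab => (fixedPoint_lt (h₁ a).1 (h₁ a).2 (h₁ b).1 (h₁ b).2 hab).1

/-- By `fixedPoint_lt`, a solution of `t = coth (t + a)` is a `1`-Lipschitz function of `a`. -/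
theorem fixedPoint_continuous (h₁ : ∀ a, 0 < t₁ a ∧ t₁ a = coth (t₁ a + a)) :
    Continuous t₁ := by
  refine (LipschitzWith.of_dist_le_mul (K := 1) fun a b => ?_).continuous
  rw [NNReal.coe_one, one_mul, dist_eq, dist_eq]
  rcases lt_trichotomy a b with h | rfl | h
  · have := fixedPoint_lt (h₁ a).1 (h₁ a).2 (h₁ b).1 (h₁ b).2 h
    rw [abs_of_pos (by linarith), abs_of_neg (by linarith)]
    linarith
  · simp
  · have := fixedPoint_lt (h₁ b).1 (h₁ b).2 (h₁ a).1 (h₁ a).2 h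
    rw [abs_of_neg (by linarith), abs_of_pos (by linarith)]
    linarith

theorem fixedPoint_neg (h₂ : ∀ a, 0 < t₂ a ∧ t₂ a = coth (t₂ a - a)) (a : ℝ) :
    0 < t₂ (-a) ∧ t₂ (-a) = coth (t₂ (-a) + a) := by
  simpa using h₂ (-a)

theorem fixedPoint_strictMono (h₂ : ∀ a, 0 < t₂ a ∧ t₂ a = coth (t₂ a - a)) : StrictMono t₂ :=
  fun _ _ hab => by simpa using fixedPoint_strictAnti (fixedPoint_neg h₂) (neg_lt_neg hab)

theorem ratio_strictAnti (h₁ : ∀ a, 0 < t₁ a ∧ t₁ a = coth (t₁ a + a))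
    (h₂ : ∀ a, 0 < t₂ a ∧ t₂ a = coth (t₂ a - a)) : StrictAnti fun a => t₁ a / t₂ a :=
  fun _ _ hab => div_lt_div₀ (fixedPoint_strictAnti h₁ hab) (fixedPoint_strictMono h₂ hab).le
    (h₁ _).1.le (h₂ _).1

theorem range_ratio (h₁ : ∀ a, 0 < t₁ a ∧ t₁ a = coth (t₁ a + a))
    (h₂ : ∀ a, 0 < t₂ a ∧ t₂ a = coth (t₂ a - a)) :
    range (fun a => t₁ a / t₂ a) = Ioi 0 := by
  refine Subset.antisymm (range_subset_iff.2 fun a => div_pos (h₁ a).1 (h₂ a).1) fun α hα => ?_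
  have hα' : 0 < α := hα
  have c₂ : Continuous t₂ := by
    simpa [Function.comp_def] using (fixedPoint_continuous (fixedPoint_neg h₂)).comp continuous_neg
  have hc : Continuous fun a => t₁ a / t₂ a :=
    (fixedPoint_continuous h₁).div c₂ fun a => (h₂ a).1.ne'
  -- since `a < t₂ a` and `-a < t₁ a`, the ratio is below `t₁ 0 / a` and above `a / t₂ 0` at `-a`
  refine mem_range_of_exists_le_of_exists_ge hc ⟨t₁ 0 / α, ?_⟩ ⟨-(t₂ 0 * α), ?_⟩
  · have ha : 0 < t₁ 0 / α := div_pos (h₁ 0).1 hα'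
    have e1 := fixedPoint_strictAnti h₁ ha
    have e2 : 0 < t₂ (t₁ 0 / α) - t₁ 0 / α := coth_pos_iff.1 ((h₂ _).2 ▸ (h₂ _).1)
    rw [div_le_iff₀ (h₂ _).1]
    calc _ ≤ t₁ 0 := e1.le
      _ = α * (t₁ 0 / α) := by field_simp
      _ ≤ _ := by gcongr; linarith
  · have ha : 0 < t₂ 0 * α := mul_pos (h₂ 0).1 hα'
    have e1 := fixedPoint_strictMono h₂ (neg_neg_of_pos ha)
    have e2 : 0 < t₁ (-(t₂ 0 * α)) + -(t₂ 0 * α) := coth_pos_iff.1 ((h₁ _).2 ▸ (h₁ _).1)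
    rw [le_div_iff₀ (h₂ _).1]
    calc _ ≤ α * t₂ 0 := by gcongr
      _ ≤ _ := by linarith

end range

/-! ### The critical catenoid -/

section catenoid

theorem hasDerivAt_vec3 {f₀ f₁ f₂ : ℝ → ℝ} {a₀ a₁ a₂ x : ℝ} (h₀ : HasDerivAt f₀ a₀ x)
    (h₁ : HasDerivAt f₁ a₁ x) (h₂ : HasDerivAt f₂ a₂ x) :
    HasDerivAt (fun y => (!₂[f₀ y, f₁ y, f₂ y] : EuclideanSpace ℝ (Fin 3))) !₂[a₀, a₁, a₂] x := by
  have h : HasDerivAt (fun y => ![f₀ y, f₁ y, f₂ y]) ![a₀, a₁, a₂] x := by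
    rw [hasDerivAt_pi]
    intro i
    fin_cases i
    · exact h₀
    · exact h₁
    · exact h₂
  exact (PiLp.continuousLinearEquiv 2 ℝ fun _ : Fin 3 => ℝ).symm.hasFDerivAt.comp_hasDerivAt x h

theorem deriv_catenoid_left (c t θ : ℝ) : deriv (fun s => c • catenoid s θ) t =
    c • (!₂[sinh t * cos θ, sinh t * sin θ, 1] : EuclideanSpace ℝ (Fin 3)) :=
  ((hasDerivAt_vec3 ((hasDerivAt_cosh t).mul_const _) ((hasDerivAt_cosh t).mul_const _)
    (hasDerivAt_id t)).const_smul c).deriv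

theorem deriv_catenoid_right (c t θ : ℝ) : deriv (fun η => c • catenoid t η) θ =
    c • (!₂[cosh t * -sin θ, cosh t * cos θ, 0] : EuclideanSpace ℝ (Fin 3)) :=
  ((hasDerivAt_vec3 ((hasDerivAt_cos θ).const_mul _) ((hasDerivAt_sin θ).const_mul _)
    (hasDerivAt_const θ t)).const_smul c).deriv

theorem norm_catenoid_sq (c t θ : ℝ) :
    ‖c • catenoid t θ‖ ^ 2 = c ^ 2 * (cosh t ^ 2 + t ^ 2) := by
  rw [EuclideanSpace.norm_sq_eq]
  simp [catenoid, Fin.sum_univ_three, mul_pow]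
  linear_combination c ^ 2 * cosh t ^ 2 * sin_sq_add_cos_sq θ

theorem inner_catenoid (c t θ : ℝ) :
    inner ℝ (deriv (fun s => c • catenoid s θ) t) (deriv (fun s => c • catenoid s θ) t)
      = (c * cosh t) ^ 2 ∧
    inner ℝ (deriv (fun s => c • catenoid s θ) t) (deriv (fun η => c • catenoid t η) θ) = 0 ∧
    inner ℝ (deriv (fun η => c • catenoid t η) θ) (deriv (fun η => c • catenoid t η) θ)
      = (c * cosh t) ^ 2 := by
  rw [deriv_catenoid_left, deriv_catenoid_right]
  simp only [PiLp.inner_apply, Fin.sum_univ_three]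
  simp [mul_pow]
  refine ⟨?_, ?_, ?_⟩
  · linear_combination c ^ 2 * sinh t ^ 2 * sin_sq_add_cos_sq θ - c ^ 2 * cosh_sq t
  · ring
  · linear_combination c ^ 2 * cosh t ^ 2 * sin_sq_add_cos_sq θ

/-- The piece `|t| ≤ τ` with `τ = coth τ`, scaled by `1 / (τ cosh τ)`, is a critical catenoid. -/
theorem exists_isCriticalCatenoid {τ : ℝ} (hτ : 0 < τ) (h : τ = coth τ) :
    ∃ g : RotMetric, IsCriticalCatenoid g := by
  have hs := sinh_pos_iff.2 hτ
  have hc := cosh_pos τ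
  have hsc : τ * sinh τ = cosh τ := by
    have := coth_mul_sinh hτ
    rwa [← h] at this
  have hpos : 0 < (τ * cosh τ)⁻¹ := by positivity
  have hone : ((τ * cosh τ)⁻¹) ^ 2 * (cosh τ ^ 2 + τ ^ 2) = 1 := by
    field_simp
    have := cosh_sq τ
    rw [← hsc] at this ⊢
    linear_combination -τ ^ 2 * this
  have hsm : ContDiff ℝ ∞ fun t => (τ * cosh τ)⁻¹ * cosh t := contDiff_const.mul contDiff_cosh
  have hp : ∀ t ∈ Icc (-τ) τ, 0 < (τ * cosh τ)⁻¹ * cosh t := fun t _ =>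
    mul_pos hpos (cosh_pos t)
  refine ⟨⟨-τ, τ, by linarith, _, _, hsm.contDiffOn, hsm.contDiffOn, hp, hp⟩,
    (τ * cosh τ)⁻¹, hpos, fun t _ θ => inner_catenoid _ t θ, fun t ht θ => ?_, fun θ => ?_,
    fun θ => ?_⟩
  · refine (sq_le_one_iff₀ (norm_nonneg _)).1 ?_
    rw [norm_catenoid_sq, ← hone]
    have h1 : |t| ≤ |τ| := by rw [abs_of_pos hτ]; exact abs_le.2 ht
    have h2 := cosh_le_cosh.2 h1
    have h3 := sq_le_sq.2 h1
    gcongr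
  · constructor <;> refine (pow_eq_one_iff_of_nonneg (norm_nonneg _) two_ne_zero).1 ?_ <;>
      simpa [norm_catenoid_sq] using hone
  · simp only [deriv_catenoid_left]
    constructor <;> ext i <;> fin_cases i <;> simp [catenoid] <;> field_simp <;>
      first
      | linear_combination cos θ * hsc
      | linear_combination sin θ * hsc

/-- The induced metric of a catenoid is conformal with factor `c cosh t` in the coordinate `t`
itself, so a critical catenoid has modulus `r₂ - r₁ = 2 τ`. -/
theorem IsCriticalCatenoid.ratio_modulus {g : RotMetric} (hg : IsCriticalCatenoid g) {τ : ℝ}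
    (hτ : 0 < τ) (h : τ = coth τ) : g.ratio = 1 ∧ g.modulus = 2 * τ := by
  obtain ⟨c, hc, hmet, -, -, hort⟩ := hg
  have hE : ∀ t ∈ Icc g.r₁ g.r₂, g.E t = c * cosh t := fun t ht =>
    ((sq_eq_sq₀ (g.pos_E t ht).le (mul_pos hc (cosh_pos t)).le).1
      ((hmet t ht 0).1.symm.trans (inner_catenoid c t 0).1))
  have hG : ∀ t ∈ Icc g.r₁ g.r₂, g.G t = c * cosh t := fun t ht =>
    ((sq_eq_sq₀ (g.pos_G t ht).le (mul_pos hc (cosh_pos t)).le).1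
      ((hmet t ht 0).2.2.symm.trans (inner_catenoid c t 0).2.2))
  have huniq : ∀ x : ℝ, 0 < x → x = coth x → x = τ := fun x hx hxc =>
    (existsUnique_eq_coth_add 0).unique ⟨hx, by rwa [add_zero]⟩ ⟨hτ, by rwa [add_zero]⟩
  -- at `θ = 0` the conormal condition gives `c r cosh r = ± 1` and `sinh r = ± c cosh² r` at the
  -- two ends, hence `r = coth r` there, with opposite signs
  obtain ⟨o1, o2⟩ := hort 0
  rw [deriv_catenoid_left, hE _ g.left_mem] at o1
  rw [deriv_catenoid_left, hE _ g.right_mem] at o2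
  have c1 := cosh_pos g.r₁
  have c2 := cosh_pos g.r₂
  have a0 := congr_arg (fun v : EuclideanSpace ℝ (Fin 3) => v 0) o1
  have a2 := congr_arg (fun v : EuclideanSpace ℝ (Fin 3) => v 2) o1
  have b0 := congr_arg (fun v : EuclideanSpace ℝ (Fin 3) => v 0) o2
  have b2 := congr_arg (fun v : EuclideanSpace ℝ (Fin 3) => v 2) o2
  simp [catenoid] at a0 a2 b0 b2
  field_simp at a0 a2 b0 b2
  have n1 : g.r₁ < 0 := by
    by_contra hn
    have := mul_nonneg (mul_pos c1 hc).le (not_lt.1 hn)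
    linarith
  have n2 : 0 < g.r₂ := by
    by_contra hn
    have := mul_nonneg (mul_pos hc c2).le (neg_nonneg.2 (not_lt.1 hn))
    linarith
  have e1 : -g.r₁ = τ := by
    refine huniq _ (neg_pos.2 n1) ?_
    rw [coth_neg, coth, neg_inj, eq_div_iff (sinh_neg_iff.2 n1).ne]
    linear_combination -g.r₁ * a0 + cosh g.r₁ * a2
  have e2 : g.r₂ = τ := by
    refine huniq _ n2 ?_
    rw [coth, eq_div_iff (sinh_pos_iff.2 n2).ne']
    linear_combination g.r₂ * b0 - cosh g.r₂ * b2
  constructor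
  · rw [g.ratio_eq, hG _ g.left_mem, hG _ g.right_mem, e2, ← e1, cosh_neg]
    exact div_self (mul_pos hc c1).ne'
  · have : g.modulus = ∫ _ in g.r₁..g.r₂, (1 : ℝ) := by
      refine intervalIntegral.integral_congr fun r hr => ?_
      rw [uIcc_of_le g.lt.le] at hr
      simp only [hE r hr, hG r hr]
      exact div_self (mul_pos hc (cosh_pos r)).ne'
    rw [this, intervalIntegral.integral_const, smul_eq_mul, mul_one]
    linarith

end catenoid

/-! ### The maximum of the normalized first eigenvalue -/

theorem theorem3p1 :
    -- the positive solutions `t₁`, `t₂` exist and are unique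
    (∀ a : ℝ, (∃! t : ℝ, 0 < t ∧ t = coth (t + a)) ∧ (∃! t : ℝ, 0 < t ∧ t = coth (t - a))) ∧
    -- the first eigenvalue is a genuine minimum
    (∀ g : RotMetric, IsLeast g.positiveEigenvalues g.sigma1) ∧
    ∀ t₁ t₂ : ℝ → ℝ,
      (∀ a, 0 < t₁ a ∧ t₁ a = coth (t₁ a + a)) →
      (∀ a, 0 < t₂ a ∧ t₂ a = coth (t₂ a - a)) →
      StrictAnti (fun a => t₁ a / t₂ a) ∧
      Set.range (fun a => t₁ a / t₂ a) = Set.Ioi 0 ∧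
      -- the optimal modulus and the maximum for a fixed ratio of the boundary lengths
      (∀ a,
        (∀ T, IsTransitionModulus (t₁ a / t₂ a) T ↔ T = t₁ a + t₂ a) ∧
        IsGreatest {x | ∃ g : RotMetric, g.ratio = t₁ a / t₂ a ∧ x = g.sigma1L}
          (2 * Real.pi * ((t₁ a)⁻¹ + (t₂ a)⁻¹)) ∧
        (∀ g : RotMetric, g.ratio = t₁ a / t₂ a →
          (g.sigma1L = 2 * Real.pi * ((t₁ a)⁻¹ + (t₂ a)⁻¹) ↔ g.modulus = t₁ a + t₂ a))) ∧
      -- the maximum over all rotationally symmetric metrics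
      t₁ 0 = coth (t₁ 0) ∧ t₁ 0 = t₂ 0 ∧
      (∀ a, 2 * Real.pi * ((t₁ a)⁻¹ + (t₂ a)⁻¹) = 4 * Real.pi / t₁ 0 ↔ a = 0) ∧
      (∀ T, IsTransitionModulus 1 T ↔ T = 2 * t₁ 0) ∧
      IsGreatest (Set.range RotMetric.sigma1L) (4 * Real.pi / t₁ 0) ∧
      (∀ g : RotMetric,
        g.sigma1L = 4 * Real.pi / t₁ 0 ↔ g.ratio = 1 ∧ g.modulus = 2 * t₁ 0) ∧
      (∀ g : RotMetric, g.sigma1L = 4 * Real.pi / t₁ 0 → g.sigma1Multiplicity = 3) ∧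
      -- the critical catenoid
      (∃ g : RotMetric, IsCriticalCatenoid g) ∧
      (∀ g : RotMetric, IsCriticalCatenoid g →
        g.sigma1L = 4 * Real.pi / t₁ 0 ∧ g.sigma1Multiplicity = 3) ∧
      -- the numerical value
      |t₁ 0 - 1.2| < 0.05 := by
  refine ⟨fun a => ⟨existsUnique_eq_coth_add a, by
    simpa only [← sub_eq_add_neg] using existsUnique_eq_coth_add (-a)⟩,
    fun g => g.sigma1_eq_min ▸ g.isLeast_positiveEigenvalues, fun t₁ t₂ h₁ h₂ => ?_⟩
  obtain ⟨hτ, hτc⟩ := h₁ 0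
  have hτ₂ := h₂ 0
  rw [add_zero] at hτc
  rw [sub_zero] at hτ₂
  have heq : t₁ 0 = t₂ 0 := (existsUnique_eq_coth_add 0).unique (h₁ 0) (by rwa [add_zero])
  have hrange := range_ratio h₁ h₂
  have hone : (1 : ℝ) = t₁ 0 / t₂ 0 := by rw [← heq, div_self hτ.ne']
  have htwo : 2 * t₁ 0 = t₁ 0 + t₂ 0 := by rw [← heq]; ring
  have hval : 4 * π / t₁ 0 = 2 * π * (2 / t₁ 0) := by ring
  have hval0 : 2 * π * ((t₁ 0)⁻¹ + (t₂ 0)⁻¹) = 4 * π / t₁ 0 := by rw [← heq]; ring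
  have hlt : ∀ a, a ≠ 0 → 2 * π * ((t₁ a)⁻¹ + (t₂ a)⁻¹) < 4 * π / t₁ 0 := fun a ha => by
    rw [hval]
    exact mul_lt_mul_of_pos_left
      (inv_add_inv_lt hτ hτc (h₁ a).1 (h₁ a).2 (h₂ a).1 (h₂ a).2 ha) two_pi_pos
  have hratio := fun a {g : RotMetric} (hr : g.ratio = t₁ a / t₂ a) =>
    RotMetric.sigma1L_le_of_ratio (h₁ a).1 (h₁ a).2 (h₂ a).1 (h₂ a).2 hr
  have hgreatest : ∀ a, IsGreatest {x | ∃ g : RotMetric, g.ratio = t₁ a / t₂ a ∧ x = g.sigma1L}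
      (2 * π * ((t₁ a)⁻¹ + (t₂ a)⁻¹)) := fun a => by
    constructor
    · obtain ⟨g, hr, hg⟩ := RotMetric.exists_metric_of_ratio (h₁ a).1 (h₂ a).1
        (add_pos (h₁ a).1 (h₂ a).1)
      exact ⟨g, hr, ((hratio a hr).2.1.2 hg).symm⟩
    · rintro x ⟨g, hr, rfl⟩
      exact (hratio a hr).1
  have hexists : ∀ g : RotMetric, ∃ a, g.ratio = t₁ a / t₂ a := fun g => by
    obtain ⟨a, ha⟩ := hrange.symm ▸ (show g.ratio ∈ Ioi 0 from g.ratio_pos)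
    exact ⟨a, ha.symm⟩
  have hle : ∀ g : RotMetric, g.sigma1L ≤ 4 * π / t₁ 0 ∧
      (g.sigma1L = 4 * π / t₁ 0 → g.ratio = 1) := fun g => by
    obtain ⟨a, ha⟩ := hexists g
    rcases eq_or_ne a 0 with rfl | h0
    · exact ⟨hval0 ▸ (hratio 0 ha).1, fun _ => ha.trans hone.symm⟩
    · have := (hratio a ha).1.trans_lt (hlt a h0)
      exact ⟨this.le, fun e => absurd e this.ne⟩
  have hiff : ∀ g : RotMetric,
      g.sigma1L = 4 * π / t₁ 0 ↔ g.ratio = 1 ∧ g.modulus = 2 * t₁ 0 := fun g => by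
    rw [htwo, ← hval0]
    constructor
    · intro h
      have hr := (hle g).2 (h.trans hval0)
      exact ⟨hr, (hratio 0 (hr.trans hone)).2.1.1 h⟩
    · rintro ⟨hr, h⟩
      exact (hratio 0 (hr.trans hone)).2.1.2 h
  have hmult : ∀ g : RotMetric, g.sigma1L = 4 * π / t₁ 0 → g.sigma1Multiplicity = 3 :=
    fun g h => by
    obtain ⟨hr, hT⟩ := (hiff g).1 h
    exact RotMetric.sigma1Multiplicity_eq_three
      ((hratio 0 (hr.trans hone)).2.2 (hT.trans htwo))
  refine ⟨ratio_strictAnti h₁ h₂, hrange, fun a => ⟨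
    isTransitionModulus_iff (h₁ a).1 (h₁ a).2 (h₂ a).1 (h₂ a).2, hgreatest a,
    fun g hr => (hratio a hr).2.1⟩, hτc, heq, fun a => ⟨fun h => ?_, ?_⟩, fun T => ?_,
    ⟨?_, ?_⟩, hiff, hmult, exists_isCriticalCatenoid hτ hτc, fun g hg => ?_,
    abs_sub_lt_of_eq_coth hτ hτc⟩
  · by_contra h0
    exact (hlt a h0).ne h
  · rintro rfl
    exact hval0
  · rw [hone, htwo]
    exact isTransitionModulus_iff (h₁ 0).1 (h₁ 0).2 (h₂ 0).1 (h₂ 0).2 T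
  · obtain ⟨g, -, hg⟩ := (hgreatest 0).1
    exact ⟨g, hg.symm.trans hval0⟩
  · rintro _ ⟨g, rfl⟩
    exact (hle g).1
  · have h := (hiff g).2 (hg.ratio_modulus hτ hτc)
    exact ⟨h, hmult g h⟩
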